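/- **Theorem (Stabilization can be hard).** A linear system $S=(A,B,H)$ with state dimension $n\ge 1$ and input dimension $p$ evolves as $$x_{k+1}=Ax_k+Bu_k+Hw_k,\qquad x_0=0,\qquad w_k\overset{\text{i.i.d.}}{\sim}\mathcal N(0,I_r),$$ with $A\in\mathbb R^{n\times n}$, $B\in\mathbb R^{n\times p}$, $H\in\mathbb R^{n\times r}$, where the noise dimension $r$ is part of the unknown system. Let $\mathcal C_k=[B\;AB\;\cdots\;A^{k-1}B]$. The pair $(A,B)$ is controllable if $\operatorname{rank}\mathcal C_k=n$ for some $k\le n$, and its controllability index is $\kappa(A,B)=\min\{k\ge1:\operatorname{rank}\mathcal C_k=n\}$. For a controllable pair with index $\kappa$ there is an orthogonal $U$ such that, with blocks of sizes $p_i=\operatorname{rank}\mathcal C_i-\operatorname{rank}\mathcal C_{i-1}$, $1\le i\le\kappa$, only the first block row $B_1$ of $U'B$ is non-zero and $U'AU=(A_{i,j})$ satisfies $A_{i,j}=0$ for $i>j+1$ (staircase form). For $\mu>0$ the pair is called $\mu$-robustly coupled if it is controllable and $\sigma_p(B_1)\ge\mu$ and $\sigma_{p_{i+1}}(A_{i+1,i})\ge\mu$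 for all $1\le i\le\kappa-1$, where $\sigma_k$ is the $k$-th largest singular value. Let $0<\mu<1$ and $M\ge1$, and, if $\kappa\ge2$, let $M\ge\sqrt{1+\mu^2}$. Let $\mathscr C$ be the class of all systems with state dimension $n$ and input dimension $p$ for which $(A,B)$ is $\mu$-robustly coupled with controllability index $\kappa$, $\|A\|_2,\|B\|_2,\|H\|_2\le M$, $\operatorname{rank}B=p$, $\operatorname{rank}H=r$, and $\rho(A)\le1$ (spectral radius). Assume that $\mathscr C$ is non-empty. Let $N\ge0$. An exploration policy $\pi$ chooses $u_t$, $t<N$, as a measurable function of $x_0,\dots,x_t,u_0,\dots,u_{t-1}$ and of an auxiliary random signal that is independent of the noise and whose law does not depend on the system. A gain estimator $\hat K_N$ is a measurable function from the data $(u_0,x_1),\dots,(u_{N-1},x_N)$ to $\mathbb R^{p\times n}$. Let $\sigma_u>0$ and suppose that $\mathbb E_{S,\pi}\|u_t\|_2^2\le\sigma_u^2$ for all $S\in\mathscr C$ and all $t<N$. Let $0\le\delta<1/2$. If $$\sup_{S\in\mathscr C}\mathbb P_{S,\pi}\big(\rho(A+B\hat K_N)\ge1\big)\le\delta,$$ then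 $$N\sigma_u^2\;\ge\;\frac12\Big(\frac1\mu\Big)^{2\kappa-2}\Big(\frac{1-\mu}{\mu}\Big)^{2}\log\frac1{3\delta},$$ where for $\delta=0$ the right-hand side is $+\infty$, i.e. the requirement cannot be met with $\delta=0$. -/

import Mathlib

open MeasureTheory ProbabilityTheory
open scoped ENNReal Matrix Matrix.Norms.L2Operator

/-- A linear system `S = (A, B, H)` with state dimension `n` and input dimension `p`; the noise
dimension `r` is part of the system:  `x (k+1) = A x k + B u k + H w k`. -/
structure LinSys (n p : ℕ) where
  r : ℕ
  A : Matrix (Fin n) (Fin n) ℝ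
  B : Matrix (Fin n) (Fin p) ℝ
  H : Matrix (Fin n) (Fin r) ℝ

/-- The spectral radius of a real square matrix: the largest modulus of a complex eigenvalue. -/
noncomputable def rho {n : ℕ} (A : Matrix (Fin n) (Fin n) ℝ) : ℝ≥0∞ :=
  spectralRadius ℂ (A.map (algebraMap ℝ ℂ))

/-- The `k`-th largest singular value `σ_k` (`k = 1, 2, …`) of a real matrix. -/
noncomputable def sigmaVal {a b : ℕ} (k : ℕ) (M : Matrix (Fin a) (Fin b) ℝ) : ℝ :=
  (Matrix.toEuclideanLin M).singularValues (k - 1)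

section Controllability

/-- The controllability matrix `[B, AB, …, A^(k-1) B]`; its columns are indexed by pairs
(power of `A`, column of `B`). -/
def ctrbMatrix {n p : ℕ} (A : Matrix (Fin n) (Fin n) ℝ) (B : Matrix (Fin n) (Fin p) ℝ) (k : ℕ) :
    Matrix (Fin n) (Fin k × Fin p) ℝ :=
  Matrix.of fun i tj => (A ^ (tj.1 : ℕ) * B) i tj.2

/-- `(A, B)` is controllable: the controllability matrix has rank `n` for some `k ≤ n`. -/
def IsControllable {n p : ℕ} (A : Matrix (Fin n) (Fin n) ℝ) (B : Matrix (Fin n) (Fin p) ℝ) :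
    Prop :=
  ∃ k ≤ n, (ctrbMatrix A B k).rank = n

/-- The controllability index `κ(A, B) = min {k ≥ 1 : rank C_k = n}` (used for controllable
pairs only). -/
noncomputable def ctrbIndex {n p : ℕ} (A : Matrix (Fin n) (Fin n) ℝ)
    (B : Matrix (Fin n) (Fin p) ℝ) : ℕ :=
  sInf {k : ℕ | 1 ≤ k ∧ (ctrbMatrix A B k).rank = n}

/-- The size `rank C_(i+1) - rank C_i` of the `i`-th diagonal block (`i = 0, 1, …`) of the
staircase form. -/
noncomputable def blockSize {n p : ℕ} (A : Matrix (Fin n) (Fin n) ℝ)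
    (B : Matrix (Fin n) (Fin p) ℝ) (i : ℕ) : ℕ :=
  (ctrbMatrix A B (i + 1)).rank - (ctrbMatrix A B i).rank

/-- Coordinates of the staircase form: a block number together with a position in that block. -/
abbrev StairIdx {n p : ℕ} (A : Matrix (Fin n) (Fin n) ℝ) (B : Matrix (Fin n) (Fin p) ℝ) : Type :=
  (i : Fin (ctrbIndex A B)) × Fin (blockSize A B i)

/-- The `i`-th block row of `Uᵀ B`. -/
noncomputable def inputBlock {n p : ℕ} (A : Matrix (Fin n) (Fin n) ℝ) (B : Matrix (Fin n) (Fin p) ℝ)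
    (U : Matrix (Fin n) (StairIdx A B) ℝ) (i : Fin (ctrbIndex A B)) :
    Matrix (Fin (blockSize A B i)) (Fin p) ℝ :=
  (Uᵀ * B).submatrix (fun a => ⟨i, a⟩) id

/-- The `(i, j)` block of `Uᵀ A U`. -/
noncomputable def stateBlock {n p : ℕ} (A : Matrix (Fin n) (Fin n) ℝ) (B : Matrix (Fin n) (Fin p) ℝ)
    (U : Matrix (Fin n) (StairIdx A B) ℝ) (i j : Fin (ctrbIndex A B)) :
    Matrix (Fin (blockSize A B i)) (Fin (blockSize A B j)) ℝ :=
  (Uᵀ * A * U).submatrix (fun a => ⟨i, a⟩) (fun b => ⟨j, b⟩)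

/-- The orthogonal matrix `U` brings `(A, B)` into staircase (block Hessenberg) form: only the
first block row of `Uᵀ B` is non-zero, and `Uᵀ A U` vanishes below its block subdiagonal. -/
structure IsStaircase {n p : ℕ} (A : Matrix (Fin n) (Fin n) ℝ) (B : Matrix (Fin n) (Fin p) ℝ)
    (U : Matrix (Fin n) (StairIdx A B) ℝ) : Prop where
  transpose_mul : Uᵀ * U = 1
  mul_transpose : U * Uᵀ = 1
  input_zero : ∀ i : Fin (ctrbIndex A B), 0 < (i : ℕ) → inputBlock A B U i = 0
  state_zero : ∀ i j : Fin (ctrbIndex A B), (j : ℕ) + 1 < (i : ℕ) → stateBlock A B U i j = 0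

/-- `(A, B)` is `μ`-robustly coupled: it is controllable and, in staircase form, `σ_p(B_1) ≥ μ`
and `σ_(p_(i+1))(A_(i+1,i)) ≥ μ` for all consecutive blocks. (The staircase form is unique up to
orthogonal changes of basis inside the blocks, which do not change these singular values.) -/
def IsRobustlyCoupled {n p : ℕ} (μ : ℝ) (A : Matrix (Fin n) (Fin n) ℝ)
    (B : Matrix (Fin n) (Fin p) ℝ) : Prop :=
  0 < μ ∧ IsControllable A B ∧ ∃ U : Matrix (Fin n) (StairIdx A B) ℝ, IsStaircase A B U ∧
    (∀ i : Fin (ctrbIndex A B), (i : ℕ) = 0 → μ ≤ sigmaVal p (inputBlock A B U i)) ∧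
    (∀ i j : Fin (ctrbIndex A B), (j : ℕ) = (i : ℕ) + 1 →
      μ ≤ sigmaVal (blockSize A B j) (stateBlock A B U j i))

/-- The class of all `μ`-robustly coupled systems of state dimension `n`, input dimension `p` and
controllability index `κ`, with the general conditions on the system: `A, B, H` have spectral norm
at most `M`, `B` and `H` have full column rank (`r ≤ n`), and `ρ(A) ≤ 1`. Norms of matrices are
spectral norms here. -/
def robustClass (n p κ : ℕ) (μ M : ℝ) : Set (LinSys n p) :=
  {S | ‖S.A‖ ≤ M ∧ ‖S.B‖ ≤ M ∧ ‖S.H‖ ≤ M ∧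
    S.B.rank = p ∧ S.H.rank = S.r ∧ rho S.A ≤ 1 ∧
    IsRobustlyCoupled μ S.A S.B ∧ ctrbIndex S.A S.B = κ}

end Controllability

section Experiment

/-- `ℝ^d` with the Euclidean norm. -/
abbrev Vec (d : ℕ) : Type := EuclideanSpace ℝ (Fin d)

/-- An exploration policy: at time `t` the input is a measurable function of
`x_0, …, x_t`, of `u_0, …, u_(t-1)` and of an auxiliary randomization signal in `𝒜`. -/
structure Policy (n p : ℕ) (𝒜 : Type*) [MeasurableSpace 𝒜] where
  act : (t : ℕ) → (Fin (t + 1) → Vec n) × (Fin t → Vec p) × 𝒜 → Vec p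
  measurable_act : ∀ t, Measurable (act t)

/-- A gain estimator: a measurable map from the data `(u_0, x_1), …, (u_(N-1), x_N)` to a
feedback gain (a `p × n` matrix). -/
structure GainEstimator (n p N : ℕ) where
  gain : (Fin N → Vec p × Vec n) → Matrix (Fin p) (Fin n) ℝ
  measurable_gain : ∀ i j, Measurable fun d => gain d i j

variable {n p : ℕ} {𝒜 : Type*} [MeasurableSpace 𝒜]

/-- The history `(x_0, …, x_t)`, `(u_0, …, u_(t-1))` of the closed loop of the system `S` and the
policy, started at `x_0 = 0`, for a realization `a` of the auxiliary signal and `w` of the noise. -/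
noncomputable def history (S : LinSys n p) (pol : Policy n p 𝒜) (a : 𝒜) (w : ℕ → Vec S.r) :
    (t : ℕ) → (Fin (t + 1) → Vec n) × (Fin t → Vec p)
  | 0 => (fun _ => 0, Fin.elim0)
  | t + 1 =>
    let h := history S pol a w t
    let u : Vec p := pol.act t (h.1, h.2, a)
    (Fin.snoc (α := fun _ => Vec n) h.1
      (Matrix.toEuclideanLin S.A (h.1 (Fin.last t)) + Matrix.toEuclideanLin S.B u
        + Matrix.toEuclideanLin S.H (w t)),
     Fin.snoc (α := fun _ => Vec p) h.2 u)

/-- The data `(u_0, x_1), …, (u_(N-1), x_N)`. -/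
noncomputable def ioData (S : LinSys n p) (pol : Policy n p 𝒜) (N : ℕ)
    (ω : 𝒜 × (ℕ → Vec S.r)) : Fin N → Vec p × Vec n :=
  fun t => ((history S pol ω.1 ω.2 N).2 t, (history S pol ω.1 ω.2 N).1 t.succ)

/-- The law of the data, when the auxiliary signal has law `ν` and is independent of
the noise `w_0, w_1, …`, which is i.i.d. standard Gaussian in `ℝ^r`. -/
noncomputable def dataLaw (S : LinSys n p) (pol : Policy n p 𝒜) (ν : Measure 𝒜) (N : ℕ) :
    Measure (Fin N → Vec p × Vec n) :=
  (ν.prod (Measure.infinitePi fun _ : ℕ => stdGaussian (Vec S.r))).map (ioData S pol N)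

/-- The input budget `E ‖u_t‖² ≤ σ²` for all `t < N`, under the system `S`. -/
def EnergyBounded (S : LinSys n p) (pol : Policy n p 𝒜) (ν : Measure 𝒜) (N : ℕ) (σ : ℝ) : Prop :=
  ∀ t : Fin N, ∫⁻ d, ‖(d t).1‖ₑ ^ 2 ∂(dataLaw S pol ν N) ≤ ENNReal.ofReal (σ ^ 2)

/-- The probability that the estimated gain fails to stabilize the system `S`:
`P (ρ(A + B K) ≥ 1)`. -/
noncomputable def failureProb (S : LinSys n p) (pol : Policy n p 𝒜) (ν : Measure 𝒜) (N : ℕ)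
    (K : GainEstimator n p N) : ℝ≥0∞ :=
  dataLaw S pol ν N {d | 1 ≤ rho (S.A + S.B * K.gain d)}

end Experiment

/-!
Arrange the coordinates of `ℝ^n` in `κ` blocks and let every block be driven, coordinate by
coordinate and with gain `μ`, by the previous one, the first block by the inputs. One coordinate `y`
of the last block integrates in addition, and it is the only one that receives noise. The two chain
systems of this shape which differ in the sign of the gain into `y` are both in the class, and
`det (1 - (A + B K))` takes opposite values for them. A stabilizing gain makes this determinant
positive, so no gain stabilizes both systems, and a good gain estimator is a good test between the
two laws of the data. The change of sign only shifts the noise by the signal which arrives at `y`;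
since each block damps this signal by `μ`, the Kullback–Leibler divergence of the two laws is at
most `2 μ ^ (2 κ) N σ ^ 2`.
-/
section RelativeEntropy

open InformationTheory

theorem mul_sub_exp_add_one_le_klFun {x : ℝ} (hx : 0 ≤ x) (s : ℝ) :
    x * s - Real.exp s + 1 ≤ klFun x := by
  rw [klFun_apply]
  rcases hx.eq_or_lt with rfl | hx
  · simp [Real.exp_nonneg]
  · have h := Real.add_one_le_exp (s - Real.log x)
    rw [Real.exp_sub, Real.exp_log hx, le_div_iff₀ hx] at h
    linarith

theorem integral_add_measureReal_univ_le_klDiv_add {α : Type*} {mα : MeasurableSpace α}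
    {P Q : Measure α} [IsFiniteMeasure P] [IsFiniteMeasure Q] (hKL : klDiv Q P ≠ ∞) {f : α → ℝ}
    (hf : Integrable f Q) (hexp : Integrable (fun x => Real.exp (f x)) P) :
    ∫ x, f x ∂Q + P.real Set.univ ≤ (klDiv Q P).toReal + ∫ x, Real.exp (f x) ∂P := by
  obtain ⟨hQP, hllr⟩ := klDiv_ne_top_iff.1 hKL
  have hden : Integrable (fun x => (Q.rnDeriv P x).toReal * f x) P := by
    simpa only [smul_eq_mul] using (integrable_rnDeriv_smul_iff hQP).2 hf
  have hmean : ∫ x, (Q.rnDeriv P x).toReal * f x ∂P = ∫ x, f x ∂Q := by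
    simpa only [smul_eq_mul] using integral_rnDeriv_smul hQP (f := f)
  calc ∫ x, f x ∂Q + P.real Set.univ
      = ∫ x, ((Q.rnDeriv P x).toReal * f x - Real.exp (f x) + 1) ∂P +
          ∫ x, Real.exp (f x) ∂P := by
        rw [integral_add (by exact hden.sub hexp) (integrable_const 1), integral_sub hden hexp,
          hmean, integral_const, smul_eq_mul, mul_one]
        ring
    _ ≤ ∫ x, klFun (Q.rnDeriv P x).toReal ∂P + ∫ x, Real.exp (f x) ∂P := by
        gcongr ?_ + _
        exact integral_mono ((hden.sub hexp).add (integrable_const 1))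
          ((integrable_klFun_rnDeriv_iff hQP).2 hllr)
          fun x => mul_sub_exp_add_one_le_klFun ENNReal.toReal_nonneg (f x)
    _ = (klDiv Q P).toReal + ∫ x, Real.exp (f x) ∂P := by
        rw [toReal_klDiv_eq_integral_klFun hQP]

theorem log_one_div_three_mul_le {δ : ℝ} (hδ₀ : 0 < δ) (hδ₁ : δ < 1 / 2) :
    Real.log (1 / (3 * δ)) ≤ (1 - 2 * δ) * Real.log ((1 - δ) / δ) := by
  have hconc : 2 * δ * Real.log (1 / δ) + (1 - 2 * δ) * Real.log (1 / (1 - δ)) ≤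
      Real.log (2 * δ * (1 / δ) + (1 - 2 * δ) * (1 / (1 - δ))) :=
    strictConcaveOn_log_Ioi.concaveOn.2 (Set.mem_Ioi.2 (by positivity))
      (Set.mem_Ioi.2 (one_div_pos.2 (by linarith))) (by linarith) (by linarith) (by ring)
  have hmean : 2 * δ * (1 / δ) + (1 - 2 * δ) * (1 / (1 - δ)) ≤ 3 := by
    have : (1 - 2 * δ) * (1 / (1 - δ)) ≤ 1 := by
      rw [mul_one_div, div_le_one (by linarith)]; linarith
    have : 2 * δ * (1 / δ) = 2 := by field_simp
    linarith
  have hlog : Real.log (2 * δ * (1 / δ) + (1 - 2 * δ) * (1 / (1 - δ))) ≤ Real.log 3 := by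
    refine Real.log_le_log (add_pos_of_pos_of_nonneg (by positivity) (mul_nonneg ?_ ?_)) hmean
    · linarith
    · exact one_div_nonneg.2 (by linarith)
  simp only [one_div, Real.log_inv] at hconc hlog ⊢
  rw [Real.log_mul three_ne_zero hδ₀.ne', Real.log_div (by linarith) hδ₀.ne']
  linarith

theorem mul_sub_add_odds_le_one {δ x : ℝ} (hδ₀ : 0 < δ) (hδ₁ : δ < 1 / 2) (hx : x ≤ δ) :
    x * ((1 - δ) / δ - δ / (1 - δ)) + δ / (1 - δ) ≤ 1 := by
  have hδ₂ : 0 < 1 - δ := by linarith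
  have hodds : 0 ≤ (1 - δ) / δ - δ / (1 - δ) := by
    rw [sub_nonneg, div_le_div_iff₀ hδ₂ hδ₀]
    nlinarith
  calc x * ((1 - δ) / δ - δ / (1 - δ)) + δ / (1 - δ)
      ≤ δ * ((1 - δ) / δ - δ / (1 - δ)) + δ / (1 - δ) := by gcongr
    _ = 1 := by field_simp; ring

/-- The test function is the log-likelihood ratio of two Bernoulli laws with success
probabilities `1 - δ` and `δ`, i.e. the worst case. -/
theorem log_one_div_three_mul_le_klDiv {α : Type*} {mα : MeasurableSpace α} {P Q : Measure α}
    [IsProbabilityMeasure P] [IsProbabilityMeasure Q] {G : Set α} (hG : MeasurableSet G) {δ : ℝ}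
    (hδ₁ : δ < 1 / 2) (hP : P.real G ≤ δ) (hQ : Q.real Gᶜ ≤ δ) (hKL : klDiv Q P ≠ ∞) :
    0 < δ ∧ Real.log (1 / (3 * δ)) ≤ (klDiv Q P).toReal := by
  have hδ₀ : 0 < δ := by
    refine (measureReal_nonneg.trans hP).lt_of_ne' fun hδ => ?_
    rw [hδ] at hP hQ
    have hPG : P G = 0 := (measureReal_eq_zero_iff).1 (hP.antisymm measureReal_nonneg)
    have hQG : Q G = 0 := (klDiv_ne_top_iff.1 hKL).1 hPG
    rw [probReal_compl_eq_one_sub hG, measureReal_def, hQG] at hQ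
    norm_num at hQ
  have hδ₂ : 0 < 1 - δ := by linarith
  refine ⟨hδ₀, (log_one_div_three_mul_le hδ₀ hδ₁).trans ?_⟩
  set a := Real.log ((1 - δ) / δ)
  have ha : 0 ≤ a := Real.log_nonneg ((one_le_div hδ₀).2 (by linarith))
  have hea : Real.exp a = (1 - δ) / δ := Real.exp_log (by positivity)
  have hexp (x : α) : Real.exp (G.indicator (fun _ => 2 * a) x - a) =
      G.indicator (fun _ => (1 - δ) / δ - δ / (1 - δ)) x + δ / (1 - δ) := by
    by_cases hx : x ∈ G
    · simp [hx, two_mul, hea]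
    · simp [hx, Real.exp_neg, hea]
  have hintf : Integrable (G.indicator fun _ => 2 * a) Q := (integrable_const _).indicator hG
  have hinte : Integrable (G.indicator fun _ => (1 - δ) / δ - δ / (1 - δ)) P :=
    (integrable_const _).indicator hG
  have hDV := integral_add_measureReal_univ_le_klDiv_add hKL (hintf.sub (integrable_const a))
    (by simp only [Pi.sub_apply, hexp]; exact hinte.add (integrable_const _))
  simp only [Pi.sub_apply, hexp] at hDV
  rw [integral_sub hintf (integrable_const a), integral_add hinte (integrable_const _),
    integral_indicator_const _ hG, integral_indicator_const _ hG] at hDV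
  simp only [integral_const, probReal_univ, smul_eq_mul, one_mul] at hDV
  have hlik := mul_sub_add_odds_le_one hδ₀ hδ₁ hP
  rw [probReal_compl_eq_one_sub hG] at hQ
  nlinarith [mul_nonneg ha (sub_nonneg.2 hQ)]

variable {α β : Type*} {mα : MeasurableSpace α} {mβ : MeasurableSpace β}

theorem rnDeriv_compProd_right [MeasurableSpace.CountableOrCountablyGenerated α β]
    {μ : Measure α} [IsFiniteMeasure μ] {κ η : Kernel α β} [IsFiniteKernel κ] [IsFiniteKernel η]
    (h : ∀ᵐ a ∂μ, κ a ≪ η a) :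
    (μ ⊗ₘ κ).rnDeriv (μ ⊗ₘ η) =ᵐ[μ ⊗ₘ η] fun x => κ.rnDeriv η x.1 x.2 := by
  have hκ : κ =ᵐ[μ] η.withDensity (κ.rnDeriv η) := by
    filter_upwards [h] with a ha using (Kernel.withDensity_rnDeriv_eq ha).symm
  rw [Measure.compProd_congr hκ, Measure.compProd_withDensity (by fun_prop)]
  exact Measure.rnDeriv_withDensity _ (by fun_prop)

theorem klDiv_compProd_right [MeasurableSpace.CountableOrCountablyGenerated α β]
    {μ : Measure α} [IsFiniteMeasure μ] {κ η : Kernel α β} [IsFiniteKernel κ] [IsFiniteKernel η]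
    (h : ∀ᵐ a ∂μ, κ a ≪ η a) :
    klDiv (μ ⊗ₘ κ) (μ ⊗ₘ η) = ∫⁻ a, klDiv (κ a) (η a) ∂μ := by
  have hd : ∀ᵐ x ∂(μ ⊗ₘ η), ENNReal.ofReal (klFun ((μ ⊗ₘ κ).rnDeriv (μ ⊗ₘ η) x).toReal) =
      ENNReal.ofReal (klFun (κ.rnDeriv η x.1 x.2).toReal) := by
    filter_upwards [rnDeriv_compProd_right h] with x hx using by rw [hx]
  rw [klDiv_eq_lintegral_klFun_of_ac (Measure.AbsolutelyContinuous.compProd_right h),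
    lintegral_congr_ae hd, Measure.lintegral_compProd (by fun_prop)]
  refine lintegral_congr_ae ?_
  filter_upwards [h] with a ha
  rw [klDiv_eq_lintegral_klFun_of_ac ha]
  refine lintegral_congr_ae ?_
  filter_upwards [Kernel.rnDeriv_eq_rnDeriv_measure (κ := κ) (η := η) (a := a)] with b hb
  rw [hb]

theorem klDiv_map_measurableEquiv (e : α ≃ᵐ β) (P Q : Measure α) [IsFiniteMeasure P]
    [IsFiniteMeasure Q] : klDiv (Q.map e) (P.map e) = klDiv Q P := by
  refine (klDiv_map_le Q P e.measurable).antisymm ?_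
  simpa only [MeasurableEquiv.map_symm_map] using
    klDiv_map_le (Q.map e) (P.map e) e.symm.measurable

theorem klDiv_prod (P Q : Measure α) [IsProbabilityMeasure P] [IsProbabilityMeasure Q]
    (P' Q' : Measure β) [IsProbabilityMeasure P'] [IsProbabilityMeasure Q'] :
    klDiv (Q.prod Q') (P.prod P') = klDiv Q P + klDiv Q' P' := by
  have hswap : klDiv (Q.prod Q') (Q.prod P') = klDiv Q' P' := by
    rw [← klDiv_map_measurableEquiv MeasurableEquiv.prodComm,
      show ⇑(MeasurableEquiv.prodComm : α × β ≃ᵐ β × α) = Prod.swap from rfl, Measure.prod_swap,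
      Measure.prod_swap, ← Measure.compProd_const, ← Measure.compProd_const, klDiv_compProd_left]
  rw [← Measure.compProd_const, ← Measure.compProd_const, klDiv_compProd_eq_add,
    Measure.compProd_const, Measure.compProd_const, hswap]

theorem klDiv_pi {r : ℕ} {E : Fin r → Type*} {mE : ∀ i, MeasurableSpace (E i)}
    (P Q : ∀ i, Measure (E i)) [∀ i, IsProbabilityMeasure (P i)]
    [∀ i, IsProbabilityMeasure (Q i)] :
    klDiv (Measure.pi Q) (Measure.pi P) = ∑ i, klDiv (Q i) (P i) := by
  induction r with
  | zero => rw [Measure.pi_of_empty Q, Measure.pi_of_empty P, klDiv_self, Fin.sum_univ_zero]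
  | succ r ih =>
    rw [← klDiv_map_measurableEquiv (MeasurableEquiv.piFinSuccAbove E 0),
      (measurePreserving_piFinSuccAbove P 0).map_eq, (measurePreserving_piFinSuccAbove Q 0).map_eq,
      klDiv_prod, ih, Fin.sum_univ_succ]
    rfl

theorem gaussianReal_eq_withDensity_gaussianReal (m m' : ℝ) {v : NNReal} (hv : v ≠ 0) :
    gaussianReal m' v = (gaussianReal m v).withDensity fun x =>
      ENNReal.ofReal (Real.exp ((m' - m) / v * x - (m' ^ 2 - m ^ 2) / (2 * v))) := by
  rw [gaussianReal_of_var_ne_zero m hv, gaussianReal_of_var_ne_zero m' hv,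
    ← withDensity_mul _ (measurable_gaussianPDF m v) (by fun_prop)]
  congr 1
  ext x
  have hv' : (v : ℝ) ≠ 0 := NNReal.coe_ne_zero.2 hv
  rw [Pi.mul_apply, gaussianPDF, gaussianPDF, ← ENNReal.ofReal_mul (gaussianPDFReal_nonneg m v x),
    gaussianPDFReal, gaussianPDFReal, mul_assoc _ (Real.exp _), ← Real.exp_add]
  congr 3
  field_simp
  ring

theorem klDiv_gaussianReal (m m' : ℝ) {v : NNReal} (hv : v ≠ 0) :
    klDiv (gaussianReal m' v) (gaussianReal m v) = ENNReal.ofReal ((m' - m) ^ 2 / (2 * v)) := by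
  have hac : gaussianReal m' v ≪ gaussianReal m v :=
    (gaussianReal_absolutelyContinuous m' hv).trans (gaussianReal_absolutelyContinuous' m hv)
  have hllr : llr (gaussianReal m' v) (gaussianReal m v) =ᵐ[gaussianReal m' v]
      fun x => (m' - m) / v * x - (m' ^ 2 - m ^ 2) / (2 * v) := by
    have hden := Measure.rnDeriv_withDensity (gaussianReal m v) (f := fun x =>
      ENNReal.ofReal (Real.exp ((m' - m) / v * x - (m' ^ 2 - m ^ 2) / (2 * v)))) (by fun_prop)
    rw [← gaussianReal_eq_withDensity_gaussianReal m m' hv] at hden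
    filter_upwards [hac.ae_le hden] with x hx
    rw [llr, hx, ENNReal.toReal_ofReal (Real.exp_nonneg _), Real.log_exp]
  have hid : Integrable (fun x : ℝ => x) (gaussianReal m' v) :=
    (memLp_id_gaussianReal 1).integrable le_rfl
  have hlin := (hid.const_mul ((m' - m) / v)).sub (integrable_const ((m' ^ 2 - m ^ 2) / (2 * v)))
  rw [← ENNReal.ofReal_toReal (klDiv_ne_top hac ((integrable_congr hllr).2 hlin)),
    toReal_klDiv_of_measure_eq hac (by simp only [measure_univ]), integral_congr_ae hllr,
    integral_sub (hid.const_mul _) (integrable_const _), integral_const_mul,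
    integral_id_gaussianReal, integral_const, probReal_univ, one_smul]
  congr 1
  field_simp
  ring

theorem stdGaussian_map_add_right {r : ℕ} (v : Vec r) :
    (stdGaussian (Vec r)).map (· + v) =
      (Measure.pi fun i => gaussianReal (v i) 1).map (WithLp.toLp 2) := by
  have hpi : (Measure.pi fun i => gaussianReal (v i) 1) =
      (Measure.pi fun _ : Fin r => gaussianReal 0 1).map fun x i => x i + v i := by
    rw [Measure.pi_map_pi (f := fun i x => x + v i) fun i => by fun_prop]
    simp only [gaussianReal_map_add_const, zero_add]
  rw [hpi, ← map_pi_eq_stdGaussian, Measure.map_map (by fun_prop) (by fun_prop),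
    Measure.map_map (by fun_prop) (by fun_prop)]
  rfl

theorem klDiv_stdGaussian_map_add_right {r : ℕ} (v : Vec r) :
    klDiv ((stdGaussian (Vec r)).map (· + v)) (stdGaussian (Vec r)) =
      ENNReal.ofReal (‖v‖ ^ 2 / 2) := by
  have hE := klDiv_map_measurableEquiv (MeasurableEquiv.toLp 2 (Fin r → ℝ))
    (Measure.pi fun _ : Fin r => gaussianReal 0 1) (Measure.pi fun i => gaussianReal (v i) 1)
  rw [MeasurableEquiv.coe_toLp, map_pi_eq_stdGaussian, ← stdGaussian_map_add_right, klDiv_pi] at hE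
  rw [hE]
  simp only [klDiv_gaussianReal _ _ one_ne_zero, EuclideanSpace.real_norm_sq_eq, sub_zero,
    NNReal.coe_one, mul_one, Finset.sum_div]
  exact (ENNReal.ofReal_sum_of_nonneg fun i _ => by positivity).symm

theorem klDiv_map_prod_stdGaussian_add {r : ℕ} (P Q : Measure α) [IsProbabilityMeasure P]
    [IsProbabilityMeasure Q] {g : α → Vec r} (hg : Measurable g) :
    klDiv ((Q.prod (stdGaussian (Vec r))).map fun z => (z.1, z.2 + g z.1))
        (P.prod (stdGaussian (Vec r))) =
      klDiv Q P + ∫⁻ x, ENNReal.ofReal (‖g x‖ ^ 2 / 2) ∂Q := by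
  set γ := stdGaussian (Vec r)
  let κ : Kernel α (Vec r) := (Kernel.id ×ₖ Kernel.const α γ).map fun z => z.2 + g z.1
  have hadd : Measurable fun z : α × Vec r => z.2 + g z.1 := by fun_prop
  have : IsMarkovKernel κ := Kernel.IsMarkovKernel.map _ hadd
  have hκ (x : α) : κ x = γ.map (· + g x) := by
    rw [Kernel.map_apply _ hadd, Kernel.prod_apply, Kernel.id_apply, Kernel.const_apply,
      Measure.dirac_prod, Measure.map_map hadd measurable_prodMk_left]
    rfl
  have hklκ (x : α) : klDiv (κ x) (Kernel.const α γ x) = ENNReal.ofReal (‖g x‖ ^ 2 / 2) := by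
    rw [hκ, Kernel.const_apply, klDiv_stdGaussian_map_add_right]
  have hac (x : α) : κ x ≪ Kernel.const α γ x :=
    (klDiv_ne_top_iff.1 (hklκ x ▸ ENNReal.ofReal_ne_top)).1
  have hcomp : (Q.prod γ).map (fun z => (z.1, z.2 + g z.1)) = Q ⊗ₘ κ := by
    ext s hs
    rw [Measure.map_apply (by fun_prop) hs, Measure.prod_apply (hs.preimage (by fun_prop)),
      Measure.compProd_apply hs]
    refine lintegral_congr fun x => ?_
    rw [hκ, Measure.map_apply (by fun_prop) (measurable_prodMk_left hs)]
    rfl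
  rw [hcomp, ← Measure.compProd_const, klDiv_compProd_eq_add,
    klDiv_compProd_right (.of_forall hac)]
  simp only [hklκ]

end RelativeEntropy
section InfiniteProduct

theorem indepFun_eval_of_dependsOn {ι β : Type*} {E : ι → Type*} {mE : ∀ i, MeasurableSpace (E i)}
    {mβ : MeasurableSpace β} (γ : ∀ i, Measure (E i)) [∀ i, IsProbabilityMeasure (γ i)]
    {f : (∀ i, E i) → β} (hf : Measurable f) {s : Finset ι} (hfs : DependsOn f s) {i : ι}
    (hi : i ∉ s) : IndepFun f (fun w => w i) (Measure.infinitePi γ) := by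
  classical
  have (j : ι) : Nonempty (E j) := nonempty_of_isProbabilityMeasure (γ j)
  have heval : iIndepFun (fun (j : ι) (w : ∀ j, E j) => w j) (Measure.infinitePi γ) :=
    iIndepFun_infinitePi (P := γ) (X := fun _ x => x) fun _ => measurable_id
  have hrestrict := heval.indepFun_finset s {i} (by simpa using hi) fun j => by fun_prop
  let w₀ : ∀ j, E j := fun j => Classical.arbitrary (E j)
  have hfac : f = (fun v => f (Function.updateFinset w₀ s v)) ∘ fun w (j : s) => w j := by
    funext w
    refine hfs fun j hj => ?_
    simp [Function.updateFinset, Finset.mem_coe.1 hj]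
  rw [hfac]
  exact hrestrict.comp (hf.comp measurable_updateFinset)
    (ψ := fun v : ((j : ({i} : Finset ι)) → E j) => v ⟨i, Finset.mem_singleton_self i⟩)
    (measurable_pi_apply _)

theorem map_prodMk_eval_eq_prod {Ω ι β : Type*} {E : ι → Type*} {mΩ : MeasurableSpace Ω}
    {mE : ∀ i, MeasurableSpace (E i)} {mβ : MeasurableSpace β} (ν : Measure Ω)
    [IsProbabilityMeasure ν] (γ : ∀ i, Measure (E i)) [∀ i, IsProbabilityMeasure (γ i)]
    {F : Ω × (∀ i, E i) → β} (hF : Measurable F) {s : Finset ι}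
    (hFs : ∀ a, DependsOn (fun w => F (a, w)) s) {i : ι} (hi : i ∉ s) :
    (ν.prod (Measure.infinitePi γ)).map (fun ω => (F ω, ω.2 i)) =
      ((ν.prod (Measure.infinitePi γ)).map F).prod (γ i) := by
  have := Measure.isProbabilityMeasure_map (μ := ν.prod (Measure.infinitePi γ)) hF.aemeasurable
  have hFi : Measurable fun ω : Ω × (∀ i, E i) => (F ω, ω.2 i) := by fun_prop
  refine (Measure.prod_eq fun S T hS hT => ?_).symm
  rw [Measure.map_apply hFi (hS.prod hT), Measure.map_apply hF hS,
    Measure.prod_apply (hFi (hS.prod hT)), Measure.prod_apply (hF hS),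
    ← lintegral_mul_const _ (measurable_measure_prodMk_left (hF hS))]
  refine lintegral_congr fun a => ?_
  have hind := indepFun_eval_of_dependsOn γ (hF.comp measurable_prodMk_left) (hFs a) hi
  rw [← Measure.infinitePi_map_eval γ i, Measure.map_apply (measurable_pi_apply i) hT]
  exact hind.measure_inter_preimage_eq_mul _ _ hS hT

end InfiniteProduct

section ClosedLoop

variable {n p : ℕ} {𝒜 : Type*} [MeasurableSpace 𝒜]

/-- The state `x_t` of the closed loop. -/
noncomputable def stateAt (S : LinSys n p) (pol : Policy n p 𝒜) (t : ℕ)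
    (ω : 𝒜 × (ℕ → Vec S.r)) : Vec n :=
  (history S pol ω.1 ω.2 t).1 (Fin.last t)

/-- The input `u_t` of the closed loop. -/
noncomputable def inputAt (S : LinSys n p) (pol : Policy n p 𝒜) (t : ℕ)
    (ω : 𝒜 × (ℕ → Vec S.r)) : Vec p :=
  pol.act t ((history S pol ω.1 ω.2 t).1, (history S pol ω.1 ω.2 t).2, ω.1)

/-- The auxiliary signal together with the history up to time `t`. Keeping the signal makes this a
Markov chain. -/
noncomputable def signalHistory (S : LinSys n p) (pol : Policy n p 𝒜) (t : ℕ)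
    (ω : 𝒜 × (ℕ → Vec S.r)) : 𝒜 × ((Fin (t + 1) → Vec n) × (Fin t → Vec p)) :=
  (ω.1, history S pol ω.1 ω.2 t)

/-- The transition of `signalHistory` driven by one noise vector. -/
noncomputable def historyStep (S : LinSys n p) (pol : Policy n p 𝒜) (t : ℕ)
    (z : (𝒜 × ((Fin (t + 1) → Vec n) × (Fin t → Vec p))) × Vec S.r) :
    𝒜 × ((Fin (t + 2) → Vec n) × (Fin (t + 1) → Vec p)) :=
  (z.1.1,
    (Fin.snoc (α := fun _ => Vec n) z.1.2.1
      (Matrix.toEuclideanLin S.A (z.1.2.1 (Fin.last t))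
        + Matrix.toEuclideanLin S.B (pol.act t (z.1.2.1, z.1.2.2, z.1.1))
        + Matrix.toEuclideanLin S.H z.2),
     Fin.snoc (α := fun _ => Vec p) z.1.2.2 (pol.act t (z.1.2.1, z.1.2.2, z.1.1))))

/-- The joint law of the auxiliary signal and of the noise. -/
noncomputable def signalNoiseLaw (ν : Measure 𝒜) (r : ℕ) : Measure (𝒜 × (ℕ → Vec r)) :=
  ν.prod (Measure.infinitePi fun _ : ℕ => stdGaussian (Vec r))

/-- The law of `signalHistory`. -/
noncomputable def historyLaw (S : LinSys n p) (pol : Policy n p 𝒜) (ν : Measure 𝒜) (t : ℕ) :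
    Measure (𝒜 × ((Fin (t + 1) → Vec n) × (Fin t → Vec p))) :=
  (signalNoiseLaw ν S.r).map (signalHistory S pol t)

/-- The data as a function of the signal and the history. -/
def dataOfHistory (n p : ℕ) (𝒜 : Type*) (N : ℕ)
    (z : 𝒜 × ((Fin (N + 1) → Vec n) × (Fin N → Vec p))) : Fin N → Vec p × Vec n :=
  fun t => (z.2.2 t, z.2.1 t.succ)

instance (ν : Measure 𝒜) [IsProbabilityMeasure ν] (r : ℕ) :
    IsProbabilityMeasure (signalNoiseLaw ν r) :=
  inferInstanceAs (IsProbabilityMeasure (ν.prod _))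

section Trajectory

variable (S : LinSys n p) (pol : Policy n p 𝒜)

theorem stateAt_zero (ω : 𝒜 × (ℕ → Vec S.r)) : stateAt S pol 0 ω = 0 := rfl

theorem stateAt_succ (t : ℕ) (ω : 𝒜 × (ℕ → Vec S.r)) :
    stateAt S pol (t + 1) ω = Matrix.toEuclideanLin S.A (stateAt S pol t ω) +
      Matrix.toEuclideanLin S.B (inputAt S pol t ω) + Matrix.toEuclideanLin S.H (ω.2 t) := by
  simp only [stateAt, inputAt, history, Fin.snoc_last]

theorem history_snd_apply {N : ℕ} (t : Fin N) (ω : 𝒜 × (ℕ → Vec S.r)) :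
    (history S pol ω.1 ω.2 N).2 t = inputAt S pol t ω := by
  induction N with
  | zero => exact t.elim0
  | succ N ih =>
    induction t using Fin.lastCases with
    | last => exact Fin.snoc_last (α := fun _ => Vec p) _ _
    | cast t => exact (Fin.snoc_castSucc (α := fun _ => Vec p) _ _ t).trans (ih t)

theorem signalHistory_succ (t : ℕ) (ω : 𝒜 × (ℕ → Vec S.r)) :
    signalHistory S pol (t + 1) ω = historyStep S pol t (signalHistory S pol t ω, ω.2 t) := rfl

theorem dependsOn_signalHistory (t : ℕ) (a : 𝒜) :
    DependsOn (fun w => signalHistory S pol t (a, w)) (Finset.range t : Set ℕ) := by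
  induction t with
  | zero => exact fun _ _ _ => rfl
  | succ t ih =>
    intro w w' hw
    have hpast : signalHistory S pol t (a, w) = signalHistory S pol t (a, w') :=
      ih fun i hi => hw i (Finset.mem_coe.2 (Finset.range_subset_range.2 t.le_succ hi))
    simp only [signalHistory_succ, hpast, hw t (Finset.mem_coe.2 (Finset.self_mem_range_succ t))]

end Trajectory

section Measurability

theorem measurable_toEuclideanLin {a b : ℕ} (M : Matrix (Fin a) (Fin b) ℝ) :
    Measurable (Matrix.toEuclideanLin M : Vec b → Vec a) :=
  (LinearMap.continuous_of_finiteDimensional _).measurable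

theorem measurable_fin_snoc {α β : Type*} [MeasurableSpace α] [MeasurableSpace β] {t : ℕ}
    {f : α → Fin t → β} {g : α → β} (hf : Measurable f) (hg : Measurable g) :
    Measurable fun a => (Fin.snoc (α := fun _ => β) (f a) (g a) : Fin (t + 1) → β) := by
  refine measurable_pi_iff.2 fun i => ?_
  induction i using Fin.lastCases with
  | last => simpa only [Fin.snoc_last] using hg
  | cast i => simpa only [Fin.snoc_castSucc] using measurable_pi_iff.1 hf i

variable (S : LinSys n p) (pol : Policy n p 𝒜)

theorem measurable_historyStep (t : ℕ) : Measurable (historyStep S pol t) := by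
  have hu : Measurable fun z : (𝒜 × ((Fin (t + 1) → Vec n) × (Fin t → Vec p))) × Vec S.r =>
      pol.act t (z.1.2.1, z.1.2.2, z.1.1) := (pol.measurable_act t).comp (by fun_prop)
  refine Measurable.prodMk (by fun_prop) (Measurable.prodMk ?_ ?_)
  · refine measurable_fin_snoc (by fun_prop) (((?_ : Measurable _).add ?_).add ?_)
    · exact (measurable_toEuclideanLin S.A).comp (by fun_prop)
    · exact (measurable_toEuclideanLin S.B).comp hu
    · exact (measurable_toEuclideanLin S.H).comp (by fun_prop)
  · exact measurable_fin_snoc (by fun_prop) hu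

theorem measurable_signalHistory (t : ℕ) : Measurable (signalHistory S pol t) := by
  induction t with
  | zero => exact Measurable.prodMk measurable_fst measurable_const
  | succ t ih => exact (measurable_historyStep S pol t).comp (ih.prodMk (by fun_prop))

theorem measurable_dataOfHistory (N : ℕ) : Measurable (dataOfHistory n p 𝒜 N) := by
  unfold dataOfHistory
  fun_prop

end Measurability

variable (S : LinSys n p) (pol : Policy n p 𝒜) (ν : Measure 𝒜)

theorem dataLaw_eq_map (N : ℕ) :
    dataLaw S pol ν N = (historyLaw S pol ν N).map (dataOfHistory n p 𝒜 N) := by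
  rw [historyLaw, Measure.map_map (measurable_dataOfHistory N) (measurable_signalHistory S pol N)]
  rfl

theorem EnergyBounded.lintegral_inputAt_le {S : LinSys n p} {pol : Policy n p 𝒜} {ν : Measure 𝒜}
    {N : ℕ} {σ : ℝ} (h : EnergyBounded S pol ν N σ) {t : ℕ} (ht : t < N) :
    ∫⁻ ω, ‖inputAt S pol t ω‖ₑ ^ 2 ∂(signalNoiseLaw ν S.r) ≤ ENNReal.ofReal (σ ^ 2) := by
  refine le_of_eq_of_le ?_ (h ⟨t, ht⟩)
  rw [dataLaw_eq_map, historyLaw, Measure.map_map (measurable_dataOfHistory N)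
    (measurable_signalHistory S pol N), lintegral_map (by fun_prop)
    ((measurable_dataOfHistory N).comp (measurable_signalHistory S pol N))]
  exact lintegral_congr fun ω => by rw [← history_snd_apply S pol ⟨t, ht⟩ ω]; rfl

variable [IsProbabilityMeasure ν]

instance (t : ℕ) : IsProbabilityMeasure (historyLaw S pol ν t) :=
  Measure.isProbabilityMeasure_map (measurable_signalHistory S pol t).aemeasurable

instance (N : ℕ) : IsProbabilityMeasure (dataLaw S pol ν N) := by
  rw [dataLaw_eq_map]
  exact Measure.isProbabilityMeasure_map (measurable_dataOfHistory N).aemeasurable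

theorem historyLaw_succ (t : ℕ) :
    historyLaw S pol ν (t + 1) =
      ((historyLaw S pol ν t).prod (stdGaussian (Vec S.r))).map (historyStep S pol t) := by
  have hm := measurable_signalHistory S pol t
  rw [historyLaw, historyLaw, signalNoiseLaw, ← map_prodMk_eval_eq_prod ν
      (fun _ : ℕ => stdGaussian (Vec S.r)) hm (dependsOn_signalHistory S pol t)
      Finset.notMem_range_self,
    Measure.map_map (measurable_historyStep S pol t) (by fun_prop)]
  rfl

end ClosedLoop

section NoiseFeedback

open InformationTheory

variable {n p : ℕ} {𝒜 : Type*} [MeasurableSpace 𝒜]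

/-- The system in which the vector `G x + F u` is added to the noise of `S`. -/
def noiseFeedback (S : LinSys n p) (G : Matrix (Fin S.r) (Fin n) ℝ)
    (F : Matrix (Fin S.r) (Fin p) ℝ) : LinSys n p :=
  ⟨S.r, S.A + S.H * G, S.B + S.H * F, S.H⟩

theorem toEuclideanLin_mul_apply {a b c : ℕ} (X : Matrix (Fin a) (Fin b) ℝ)
    (Y : Matrix (Fin b) (Fin c) ℝ) (x : Vec c) :
    Matrix.toEuclideanLin (X * Y) x = Matrix.toEuclideanLin X (Matrix.toEuclideanLin Y x) :=
  LinearMap.congr_fun (Matrix.toLpLin_mul_same 2 X Y) x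

variable (S : LinSys n p) (G : Matrix (Fin S.r) (Fin n) ℝ) (F : Matrix (Fin S.r) (Fin p) ℝ)
  (pol : Policy n p 𝒜) (ν : Measure 𝒜)

theorem historyStep_noiseFeedback (t : ℕ)
    (z : (𝒜 × ((Fin (t + 1) → Vec n) × (Fin t → Vec p))) × Vec S.r) :
    historyStep (noiseFeedback S G F) pol t z =
      historyStep S pol t (z.1, z.2 + (Matrix.toEuclideanLin G (z.1.2.1 (Fin.last t)) +
        Matrix.toEuclideanLin F (pol.act t (z.1.2.1, z.1.2.2, z.1.1)))) := by
  have hnext (x : Vec n) (u : Vec p) (w : Vec S.r) :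
      Matrix.toEuclideanLin (S.A + S.H * G) x + Matrix.toEuclideanLin (S.B + S.H * F) u +
          Matrix.toEuclideanLin S.H w =
        Matrix.toEuclideanLin S.A x + Matrix.toEuclideanLin S.B u + Matrix.toEuclideanLin S.H
          (w + (Matrix.toEuclideanLin G x + Matrix.toEuclideanLin F u)) := by
    simp only [map_add, LinearMap.add_apply, toEuclideanLin_mul_apply]
    abel
  exact congrArg (fun x => (z.1.1, Fin.snoc (α := fun _ => Vec n) z.1.2.1 x,
    Fin.snoc (α := fun _ => Vec p) z.1.2.2 (pol.act t (z.1.2.1, z.1.2.2, z.1.1)))) (hnext _ _ _)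

variable [IsProbabilityMeasure ν]

/-- Feedback into the noise channel shifts the Gaussian noise of each step by a function of the
past, so the chain rule applies. -/
theorem klDiv_historyLaw_noiseFeedback_le (t : ℕ) :
    klDiv (historyLaw (noiseFeedback S G F) pol ν t) (historyLaw S pol ν t) ≤
      ∑ i ∈ Finset.range t, ∫⁻ ω, ENNReal.ofReal
        (‖Matrix.toEuclideanLin G (stateAt (noiseFeedback S G F) pol i ω) +
          Matrix.toEuclideanLin F (inputAt (noiseFeedback S G F) pol i ω)‖ ^ 2 / 2)
        ∂signalNoiseLaw ν (noiseFeedback S G F).r := by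
  set S' := noiseFeedback S G F
  induction t with
  | zero => exact (klDiv_self (historyLaw S pol ν 0)).le
  | succ t ih =>
    let g (z : 𝒜 × ((Fin (t + 1) → Vec n) × (Fin t → Vec p))) : Vec S.r :=
      Matrix.toEuclideanLin G (z.2.1 (Fin.last t)) +
        Matrix.toEuclideanLin F (pol.act t (z.2.1, z.2.2, z.1))
    have hg : Measurable g := ((measurable_toEuclideanLin G).comp (by fun_prop)).add
      ((measurable_toEuclideanLin F).comp ((pol.measurable_act t).comp (by fun_prop)))
    have hstep : historyStep S' pol t = historyStep S pol t ∘ fun z => (z.1, z.2 + g z.1) :=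
      funext fun z => historyStep_noiseFeedback S G F pol t z
    calc klDiv (historyLaw S' pol ν (t + 1)) (historyLaw S pol ν (t + 1))
        ≤ klDiv (((historyLaw S' pol ν t).prod (stdGaussian (Vec S.r))).map
              fun z => (z.1, z.2 + g z.1))
            ((historyLaw S pol ν t).prod (stdGaussian (Vec S.r))) := by
          rw [historyLaw_succ, historyLaw_succ, hstep,
            ← Measure.map_map (measurable_historyStep S pol t) (by fun_prop)]
          exact klDiv_map_le _ _ (measurable_historyStep S pol t)
      _ = klDiv (historyLaw S' pol ν t) (historyLaw S pol ν t) +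
            ∫⁻ z, ENNReal.ofReal (‖g z‖ ^ 2 / 2) ∂(historyLaw S' pol ν t) :=
          klDiv_map_prod_stdGaussian_add _ _ hg
      _ ≤ _ := by
          rw [Finset.sum_range_succ, historyLaw, lintegral_map (by fun_prop)
            (measurable_signalHistory S' pol t)]
          exact add_le_add_left ih _

theorem klDiv_dataLaw_noiseFeedback_le (N : ℕ) :
    klDiv (dataLaw (noiseFeedback S G F) pol ν N) (dataLaw S pol ν N) ≤
      ∑ i ∈ Finset.range N, ∫⁻ ω, ENNReal.ofReal
        (‖Matrix.toEuclideanLin G (stateAt (noiseFeedback S G F) pol i ω) +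
          Matrix.toEuclideanLin F (inputAt (noiseFeedback S G F) pol i ω)‖ ^ 2 / 2)
        ∂signalNoiseLaw ν (noiseFeedback S G F).r := by
  rw [dataLaw_eq_map, dataLaw_eq_map]
  exact (klDiv_map_le _ _ (measurable_dataOfHistory N)).trans
    (klDiv_historyLaw_noiseFeedback_le S G F pol ν N)

end NoiseFeedback

section SpectralRadius

variable {n : ℕ} {A : Matrix (Fin n) (Fin n) ℝ}

theorem enorm_le_rho_of_det_eq_zero {x : ℝ} (h : (x • 1 - A).det = 0) : ‖x‖ₑ ≤ rho A := by
  have hmem : (x : ℂ) ∈ spectrum ℂ (A.map (algebraMap ℝ ℂ)) := by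
    have hmap : algebraMap ℂ (Matrix (Fin n) (Fin n) ℂ) x - A.map (algebraMap ℝ ℂ) =
        (algebraMap ℝ ℂ).mapMatrix (x • 1 - A) := by
      ext i j
      by_cases hij : i = j <;> simp [hij, Matrix.algebraMap_matrix_apply]
    rw [spectrum.mem_iff, Matrix.isUnit_iff_isUnit_det, hmap, ← RingHom.map_det, h, map_zero]
    exact not_isUnit_zero
  calc ‖x‖ₑ = ((‖(x : ℂ)‖₊ : NNReal) : ℝ≥0∞) := by simp [enorm_eq_nnnorm]
    _ ≤ rho A := le_iSup₂ (α := ℝ≥0∞) (x : ℂ) hmem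

-- The determinant of `1 - s • A` starts at `1` for `s = 0`, so it vanishes for some `s ∈ (0, 1]`,
-- and `s⁻¹` is an eigenvalue.
theorem one_le_rho_of_det_one_sub_nonpos (h : (1 - A).det ≤ 0) : 1 ≤ rho A := by
  have hcont : Continuous fun s : ℝ => (1 - s • A).det := by fun_prop
  obtain ⟨s, ⟨hs₀, hs₁⟩, hs : (1 - s • A).det = 0⟩ :=
    intermediate_value_Icc' zero_le_one hcont.continuousOn
      (show (0 : ℝ) ∈ Set.Icc _ _ by simpa using h)
  have hs' : s ≠ 0 := by
    rintro rfl
    simp at hs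
  have hdet : (s⁻¹ • 1 - A).det = 0 := by
    have : s⁻¹ • (1 : Matrix (Fin n) (Fin n) ℝ) - A = s⁻¹ • (1 - s • A) := by
      rw [smul_sub, smul_smul, inv_mul_cancel₀ hs', one_smul]
    rw [this, Matrix.det_smul, hs, mul_zero]
  refine le_trans ?_ (enorm_le_rho_of_det_eq_zero hdet)
  rw [← ofReal_norm, ENNReal.one_le_ofReal, Real.norm_of_nonneg (by positivity)]
  exact (one_le_inv₀ (hs₀.lt_of_ne' hs')).2 hs₁

theorem rho_le_of_triangular (b : Fin n → ℕ) {c : NNReal}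
    (htri : ∀ i j, i ≠ j → b i ≤ b j → A i j = 0) (hdiag : ∀ i, ‖A i i‖₊ ≤ c) : rho A ≤ c := by
  refine iSup₂_le fun l hl => ?_
  rw [← Matrix.spectrum_toLin', ← Module.End.hasEigenvalue_iff_mem_spectrum] at hl
  obtain ⟨v, hv⟩ := hl.exists_hasEigenvector
  have heq (i : Fin n) : ∑ j, (A i j : ℂ) * v j = l * v i := by
    simpa [Matrix.mulVec, dotProduct] using congrFun hv.apply_eq_smul i
  by_contra! hlt
  have hzero (k : ℕ) : ∀ i, b i = k → v i = 0 := by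
    induction k using Nat.strong_induction_on with
    | _ k ih =>
      intro i hi
      have hoff (j : Fin n) (hji : j ≠ i) : (A i j : ℂ) * v j = 0 := by
        rcases lt_or_ge (b j) (b i) with hlt | hle
        · rw [ih (b j) (hi ▸ hlt) j rfl, mul_zero]
        · rw [htri i j hji.symm hle, Complex.ofReal_zero, zero_mul]
      have hii := heq i
      rw [Finset.sum_eq_single i (fun j _ => hoff j) (by simp)] at hii
      refine (mul_eq_mul_right_iff.1 hii).resolve_left fun hl => hlt.not_ge ?_
      rw [← hl, Complex.nnnorm_real]
      exact_mod_cast hdiag i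
  exact hv.2 (funext fun i => hzero (b i) i rfl)

end SpectralRadius

section SingularValues

variable {a b k : ℕ} {X : Matrix (Fin a) (Fin b) ℝ} {μ : ℝ}

theorem finrank_range_toEuclideanLin (X : Matrix (Fin a) (Fin b) ℝ) :
    Module.finrank ℝ (Matrix.toEuclideanLin X).range = X.rank := by
  rw [Matrix.rank_eq_finrank_range_toLin X (EuclideanSpace.basisFun _ ℝ).toBasis
    (EuclideanSpace.basisFun _ ℝ).toBasis, Matrix.toEuclideanLin_eq_toLin_orthonormal]

theorem sigmaVal_pos_iff : 0 < sigmaVal k X ↔ k - 1 < X.rank := by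
  rw [sigmaVal, LinearMap.singularValues_pos_iff_lt_finrank_range, finrank_range_toEuclideanLin]

theorem rank_eq_of_mul_transpose_eq_smul_one (hμ : μ ≠ 0) (h : X * Xᵀ = μ ^ 2 • 1) :
    X.rank = a := by
  rw [← Matrix.rank_self_mul_transpose, h, Matrix.rank_smul_of_mem_nonZeroDivisors _
    (mem_nonZeroDivisors_of_ne_zero (pow_ne_zero 2 hμ)), Matrix.rank_one, Fintype.card_fin]

theorem sigmaVal_eq_of_mul_transpose_eq_smul_one (hμ : 0 < μ) (h : X * Xᵀ = μ ^ 2 • 1)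
    (hk : k - 1 < a) : sigmaVal k X = μ := by
  have hpos : 0 < sigmaVal k X :=
    sigmaVal_pos_iff.2 (hk.trans_eq (rank_eq_of_mul_transpose_eq_smul_one hμ.ne' h).symm)
  have hkb : k - 1 < Module.finrank ℝ (Vec b) := by
    rw [finrank_euclideanSpace_fin]
    exact (sigmaVal_pos_iff.1 hpos).trans_le X.rank_le_width
  set T := Matrix.toEuclideanLin X
  obtain ⟨v, hv⟩ := (T.hasEigenvalue_adjoint_comp_self_sq_singularValues hkb).exists_hasEigenvector
  have hev : LinearMap.adjoint T (T v) = sigmaVal k X ^ 2 • v := hv.apply_eq_smul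
  have hTT (w : Vec a) : T (LinearMap.adjoint T w) = μ ^ 2 • w := by
    rw [← Matrix.toEuclideanLin_conjTranspose_eq_adjoint,
      Matrix.conjTranspose_eq_transpose_of_trivial, ← toEuclideanLin_mul_apply, h, map_smul]
    simp
  have hTv : T v ≠ 0 := fun h₀ => by
    rw [h₀, map_zero] at hev
    exact hv.2 ((smul_eq_zero.1 hev.symm).resolve_left (by positivity))
  have hsq : μ ^ 2 = sigmaVal k X ^ 2 := smul_left_injective ℝ hTv <| by
    simpa only [hTT, map_smul] using congrArg T hev
  exact ((pow_left_inj₀ hμ.le hpos.le two_ne_zero).1 hsq).symm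

theorem l2_opNorm_le_of_mul_transpose_eq_diagonal {d : Fin a → ℝ} {C : ℝ}
    (h : X * Xᵀ = Matrix.diagonal d) (hC : 0 ≤ C) (hd : ∀ i, |d i| ≤ C ^ 2) : ‖X‖ ≤ C := by
  have hsq : ‖X‖ * ‖X‖ = ‖d‖ := by
    rw [← Matrix.l2_opNorm_conjTranspose X, ← Matrix.l2_opNorm_conjTranspose_mul_self,
      Matrix.conjTranspose_conjTranspose, Matrix.conjTranspose_eq_transpose_of_trivial, h,
      Matrix.l2_opNorm_diagonal]
  refine abs_le_of_sq_le_sq' ?_ hC |>.2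
  rw [sq, hsq]
  exact (pi_norm_le_iff_of_nonneg (by positivity)).2 hd

end SingularValues

section Matching

variable {ι κ R : Type*} [Fintype κ] [DecidableEq ι] [CommSemiring R]

theorem mul_transpose_eq_diagonal_of_matching {r : ι → κ → Prop} [DecidableRel r]
    (hr : Relator.BiUnique r) {X : Matrix ι κ R} {c : ι → R}
    (hX : ∀ i j, X i j = if r i j then c i else 0) [DecidablePred fun i => ∃ j, r i j] :
    X * Xᵀ = Matrix.diagonal fun i => if ∃ j, r i j then c i ^ 2 else 0 := by
  ext i k
  rw [Matrix.mul_apply]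
  by_cases hi : ∃ j, r i j
  · obtain ⟨j, hj⟩ := hi
    rw [Finset.sum_eq_single j (fun j' _ hj' => by
      rw [hX, if_neg fun h => hj' (hr.2 h hj), zero_mul]) (by simp)]
    simp only [Matrix.transpose_apply, hX, if_pos hj]
    by_cases hik : i = k
    · subst hik
      rw [Matrix.diagonal_apply_eq, if_pos hj, if_pos ⟨j, hj⟩, sq]
    · rw [Matrix.diagonal_apply_ne _ hik, if_neg fun h => hik (hr.1 hj h), mul_zero]
  · rw [Finset.sum_eq_zero fun j _ => by rw [hX, if_neg fun h => hi ⟨j, h⟩, zero_mul],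
      Matrix.diagonal_apply, if_neg hi, ite_self]

end Matching

section StaircaseLayout

/-- An arrangement of the coordinates of `ℝ^n` in `κ` non-empty blocks of non-increasing sizes, the
first of size `p`. These are the dimensions of the diagonal blocks of a staircase form. -/
structure StaircaseLayout (n p κ : ℕ) where
  size : ℕ → ℕ
  coord : Fin n ≃ (b : Fin κ) × Fin (size b)
  index_pos : 0 < κ
  size_zero : size 0 = p
  size_pos : ∀ b < κ, 0 < size b
  size_succ_le : ∀ b, b + 1 < κ → size (b + 1) ≤ size b

namespace StaircaseLayout

variable {n p κ : ℕ} (L : StaircaseLayout n p κ)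

/-- The number of the block of a coordinate. -/
def blk (i : Fin n) : ℕ := (L.coord i).1

/-- The position of a coordinate in its block. -/
def pos (i : Fin n) : ℕ := (L.coord i).2

theorem blk_lt (i : Fin n) : L.blk i < κ := (L.coord i).1.2

theorem pos_lt (i : Fin n) : L.pos i < L.size (L.blk i) := (L.coord i).2.2

theorem exists_blk_eq_pos_eq {b a : ℕ} (hb : b < κ) (ha : a < L.size b) :
    ∃ i, L.blk i = b ∧ L.pos i = a := by
  have hs := L.coord.apply_symm_apply ⟨⟨b, hb⟩, ⟨a, ha⟩⟩
  exact ⟨L.coord.symm ⟨⟨b, hb⟩, ⟨a, ha⟩⟩, congrArg (fun s => (s.1 : ℕ)) hs,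
    congrArg (fun s => (s.2 : ℕ)) hs⟩

variable {L} in
theorem eq_of_blk_eq_of_pos_eq {i j : Fin n} (hb : L.blk i = L.blk j) (hp : L.pos i = L.pos j) :
    i = j := by
  refine L.coord.injective (Sigma.ext (Fin.ext hb) ?_)
  exact (Fin.heq_ext_iff (congrArg L.size hb)).2 hp

theorem pos_lt_input (i : Fin n) : L.pos i < p := by
  have hle (b : ℕ) : b < κ → L.size b ≤ p := by
    induction b with
    | zero => exact fun _ => L.size_zero.le
    | succ b ih => exact fun hb => (L.size_succ_le b hb).trans (ih (b.lt_succ_self.trans hb))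
  exact (L.pos_lt i).trans_le (hle _ (L.blk_lt i))

theorem exists_pred {i : Fin n} (hi : L.blk i ≠ 0) :
    ∃ j, L.blk i = L.blk j + 1 ∧ L.pos i = L.pos j := by
  obtain ⟨b, hb⟩ := Nat.exists_eq_succ_of_ne_zero hi
  have hbκ : b + 1 < κ := hb.symm.trans_lt (L.blk_lt i)
  obtain ⟨j, hjb, hjp⟩ := L.exists_blk_eq_pos_eq (b.lt_succ_self.trans hbκ)
    ((L.pos_lt i).trans_le (hb ▸ L.size_succ_le b hbκ))
  exact ⟨j, by rw [hb, hjb], hjp.symm⟩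

include L in
theorem index_le : κ ≤ n := by
  simpa using Fintype.card_le_of_injective
    (fun b : Fin κ => L.coord.symm ⟨b, 0, L.size_pos b b.2⟩)
    fun b b' h => congrArg Sigma.fst (L.coord.symm.injective h)

theorem card_filter_blk_eq {b : ℕ} (hb : b < κ) :
    (Finset.univ.filter fun i => L.blk i = b).card = L.size b := by
  rw [← Finset.card_range (L.size b)]
  refine Finset.card_nbij L.pos (fun i hi => ?_) (fun i hi j hj hij => ?_) fun a ha => ?_
  · exact Finset.mem_range.2 ((Finset.mem_filter.1 hi).2 ▸ L.pos_lt i)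
  · exact eq_of_blk_eq_of_pos_eq
      ((Finset.mem_filter.1 hi).2.trans (Finset.mem_filter.1 hj).2.symm) hij
  · obtain ⟨i, hib, hia⟩ := L.exists_blk_eq_pos_eq hb (Finset.mem_range.1 ha)
    exact ⟨i, Finset.mem_filter.2 ⟨Finset.mem_univ i, hib⟩, hia⟩

theorem exists_blk_add_one_eq : ∃ y, L.blk y + 1 = κ := by
  have hκ := L.index_pos
  obtain ⟨y, hy, -⟩ := L.exists_blk_eq_pos_eq (Nat.sub_one_lt_of_lt hκ)
    (L.size_pos _ (Nat.sub_one_lt_of_lt hκ))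
  exact ⟨y, by lia⟩

/-- The matrix moving the entries of each block to the same positions of the next block. -/
def shift : Matrix (Fin n) (Fin n) ℝ :=
  Matrix.of fun i j => if L.blk i = L.blk j + 1 ∧ L.pos i = L.pos j then 1 else 0

/-- The matrix feeding the inputs into the first block. -/
def feed : Matrix (Fin n) (Fin p) ℝ :=
  Matrix.of fun i a => if L.blk i = 0 ∧ L.pos i = a then 1 else 0

theorem shift_mulVec_of_pred {i j : Fin n} (hb : L.blk i = L.blk j + 1) (hp : L.pos i = L.pos j)
    (v : Fin n → ℝ) : (L.shift *ᵥ v) i = v j := by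
  rw [Matrix.mulVec, dotProduct, Finset.sum_eq_single j]
  · rw [shift, Matrix.of_apply, if_pos ⟨hb, hp⟩, one_mul]
  · intro k _ hk
    rw [shift, Matrix.of_apply, if_neg, zero_mul]
    exact fun h => hk (eq_of_blk_eq_of_pos_eq (L := L) (by lia) (by lia))
  · simp

theorem shift_mulVec_of_blk_eq_zero {i : Fin n} (hi : L.blk i = 0) (v : Fin n → ℝ) :
    (L.shift *ᵥ v) i = 0 := by
  rw [Matrix.mulVec, dotProduct]
  exact Finset.sum_eq_zero fun j _ => by rw [shift, Matrix.of_apply, if_neg (by lia), zero_mul]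

theorem feed_mulVec_of_blk_eq_zero {i : Fin n} (hi : L.blk i = 0) (u : Fin p → ℝ) :
    (L.feed *ᵥ u) i = u ⟨L.pos i, L.pos_lt_input i⟩ := by
  rw [Matrix.mulVec, dotProduct, Finset.sum_eq_single ⟨L.pos i, L.pos_lt_input i⟩]
  · rw [feed, Matrix.of_apply, if_pos ⟨hi, rfl⟩, one_mul]
  · intro a _ ha
    rw [feed, Matrix.of_apply, if_neg fun h => ha (Fin.ext h.2.symm), zero_mul]
  · simp

theorem feed_mulVec_of_blk_ne_zero {i : Fin n} (hi : L.blk i ≠ 0) (u : Fin p → ℝ) :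
    (L.feed *ᵥ u) i = 0 := by
  rw [Matrix.mulVec, dotProduct]
  exact Finset.sum_eq_zero fun a _ => by
    rw [feed, Matrix.of_apply, if_neg fun h => hi h.1, zero_mul]

theorem shift_pow_mul_feed_apply (t : ℕ) (i : Fin n) (a : Fin p) :
    (L.shift ^ t * L.feed) i a = if L.blk i = t ∧ L.pos i = a then 1 else 0 := by
  induction t generalizing i with
  | zero => rw [pow_zero, Matrix.one_mul, feed, Matrix.of_apply]
  | succ t ih =>
    have hmul : (L.shift ^ (t + 1) * L.feed) i a =
        (L.shift *ᵥ fun j => (L.shift ^ t * L.feed) j a) i := by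
      rw [pow_succ', Matrix.mul_assoc]
      rfl
    rw [hmul]
    by_cases hi : L.blk i = 0
    · rw [L.shift_mulVec_of_blk_eq_zero hi, if_neg (by lia)]
    · obtain ⟨j, hb, hp⟩ := L.exists_pred hi
      rw [L.shift_mulVec_of_pred hb hp, ih, hb, hp]
      simp only [Nat.add_right_cancel_iff]

end StaircaseLayout

end StaircaseLayout

section Chain

namespace StaircaseLayout

variable {n p κ : ℕ} (L : StaircaseLayout n p κ) {y : Fin n} {μ ε M : ℝ}

/-- The change of the sign of the coordinate `y` (for `ε = -1`). -/
def signMatrix (y : Fin n) (ε : ℝ) : Matrix (Fin n) (Fin n) ℝ :=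
  Matrix.diagonal (Function.update 1 y ε)

/-- The state matrix of the chain system: the coordinate `y` integrates, and all coordinates are
driven, with gain `±μ`, by the coordinates at the same position of the previous block. -/
def chainA (y : Fin n) (μ ε : ℝ) : Matrix (Fin n) (Fin n) ℝ :=
  Matrix.single y y 1 + μ • (signMatrix y ε * L.shift)

/-- The input matrix of the chain system: the inputs drive the first block with gain `±μ`. -/
def chainB (y : Fin n) (μ ε : ℝ) : Matrix (Fin n) (Fin p) ℝ :=
  μ • (signMatrix y ε * L.feed)

/-- The noise matrix of the chain system: a scalar noise enters at the coordinate `y`. -/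
def chainH (y : Fin n) : Matrix (Fin n) (Fin 1) ℝ :=
  Matrix.single y 0 1

/-- The chain system. It will be used for a coordinate `y` of the last block and signs `ε = ±1`. -/
def chainSys (y : Fin n) (μ ε : ℝ) : LinSys n p :=
  ⟨1, L.chainA y μ ε, L.chainB y μ ε, chainH y⟩

theorem signMatrix_mul_apply {m : Type*} (X : Matrix (Fin n) m ℝ) (i : Fin n) (a : m) :
    (signMatrix y ε * X) i a = (Function.update 1 y ε : Fin n → ℝ) i * X i a :=
  Matrix.diagonal_mul _ X i a

theorem signMatrix_mul_of_row_eq_zero {m : Type*} {X : Matrix (Fin n) m ℝ} (hX : X y = 0) :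
    signMatrix y ε * X = X := by
  ext i a
  rw [signMatrix_mul_apply]
  by_cases hi : i = y
  · rw [hi, hX, Pi.zero_apply, mul_zero]
  · rw [Function.update_of_ne hi, Pi.one_apply, one_mul]

theorem single_mul_of_row_eq_zero {m : Type*} {X : Matrix (Fin n) m ℝ} (hX : X y = 0) :
    Matrix.single y y (1 : ℝ) * X = 0 := by
  ext i a
  by_cases hi : i = y
  · rw [hi, Matrix.single_mul_apply_same, hX, one_mul, Pi.zero_apply, Matrix.zero_apply]
  · rw [Matrix.single_mul_apply_of_ne _ _ _ _ _ hi, Matrix.zero_apply]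

theorem chainA_apply_of_blk_ne {i j : Fin n} (hij : L.blk i ≠ L.blk j) :
    L.chainA y μ ε i j = if L.blk i = L.blk j + 1 ∧ L.pos i = L.pos j then
      μ * (Function.update 1 y ε : Fin n → ℝ) i else 0 := by
  rw [chainA, Matrix.add_apply, Matrix.single_apply, if_neg fun h => hij (by rw [← h.1, ← h.2]),
    Matrix.smul_apply, signMatrix_mul_apply, shift, Matrix.of_apply, smul_eq_mul, mul_ite,
    mul_ite, mul_one, mul_zero, mul_zero, zero_add]

theorem chainB_apply (i : Fin n) (a : Fin p) :
    L.chainB y μ ε i a =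
      if L.blk i = 0 ∧ L.pos i = a then μ * (Function.update 1 y ε : Fin n → ℝ) i else 0 := by
  rw [chainB, Matrix.smul_apply, signMatrix_mul_apply, feed, Matrix.of_apply, smul_eq_mul,
    mul_ite, mul_ite, mul_one, mul_zero, mul_zero]

theorem update_one_sq (hε : ε ^ 2 = 1) (i : Fin n) :
    (Function.update 1 y ε : Fin n → ℝ) i ^ 2 = 1 := by
  by_cases hi : i = y
  · rw [hi, Function.update_self, hε]
  · rw [Function.update_of_ne hi, Pi.one_apply, one_pow]

theorem chainA_pow_mul_chainB (hy : L.blk y + 1 = κ) {t : ℕ} (ht : t < κ) :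
    L.chainA y μ ε ^ t * L.chainB y μ ε =
      μ ^ (t + 1) • (signMatrix y ε * (L.shift ^ t * L.feed)) := by
  induction t with
  | zero => rw [pow_zero, pow_zero, Matrix.one_mul, Matrix.one_mul, zero_add, pow_one, chainB]
  | succ t ih =>
    have hrow : (L.shift ^ t * L.feed) y = 0 := by
      ext a
      rw [L.shift_pow_mul_feed_apply, if_neg (by lia), Pi.zero_apply]
    rw [pow_succ', Matrix.mul_assoc, ih (by lia), signMatrix_mul_of_row_eq_zero hrow, chainA,
      Matrix.mul_smul, Matrix.add_mul, single_mul_of_row_eq_zero hrow, zero_add, Matrix.smul_mul,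
      smul_smul, ← pow_succ, Matrix.mul_assoc, ← Matrix.mul_assoc L.shift, ← pow_succ']

theorem ctrbMatrix_chain_mul_transpose (hy : L.blk y + 1 = κ) (hε : ε ^ 2 = 1) {k : ℕ}
    (hk : k ≤ κ) :
    ctrbMatrix (L.chainA y μ ε) (L.chainB y μ ε) k *
        (ctrbMatrix (L.chainA y μ ε) (L.chainB y μ ε) k)ᵀ =
      Matrix.diagonal fun i => if L.blk i < k then (μ ^ (L.blk i + 1)) ^ 2 else 0 := by
  classical
  rw [mul_transpose_eq_diagonal_of_matching
    (r := fun i (ta : Fin k × Fin p) => L.blk i = ta.1 ∧ L.pos i = ta.2)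
    (c := fun i => (Function.update 1 y ε : Fin n → ℝ) i * μ ^ (L.blk i + 1))]
  · congr 1
    ext i
    rw [mul_pow, update_one_sq hε, one_mul]
    refine if_congr ⟨fun ⟨ta, h, _⟩ => h ▸ ta.1.2, fun hi => ?_⟩ rfl rfl
    exact ⟨(⟨L.blk i, hi⟩, ⟨L.pos i, L.pos_lt_input i⟩), rfl, rfl⟩
  · exact ⟨fun i ta j h h' => eq_of_blk_eq_of_pos_eq (h.1.trans h'.1.symm) (h.2.trans h'.2.symm),
      fun i ta ta' h h' =>
        Prod.ext (Fin.ext (h.1.symm.trans h'.1)) (Fin.ext (h.2.symm.trans h'.2))⟩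
  · rintro i ⟨t, a⟩
    rw [ctrbMatrix, Matrix.of_apply, L.chainA_pow_mul_chainB hy (t.2.trans_le hk),
      Matrix.smul_apply, signMatrix_mul_apply, L.shift_pow_mul_feed_apply, smul_eq_mul]
    split_ifs with h
    · rw [h.1, mul_one, mul_comm]
    · rw [mul_zero, mul_zero]

theorem rank_ctrbMatrix_chain (hy : L.blk y + 1 = κ) (hμ : μ ≠ 0) (hε : ε ^ 2 = 1) {k : ℕ}
    (hk : k ≤ κ) :
    (ctrbMatrix (L.chainA y μ ε) (L.chainB y μ ε) k).rank =
      (Finset.univ.filter fun i => L.blk i < k).card := by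
  rw [← Matrix.rank_self_mul_transpose, L.ctrbMatrix_chain_mul_transpose hy hε hk,
    Matrix.rank_diagonal, Fintype.card_subtype]
  congr 1
  ext i
  simp [hμ]

theorem rank_ctrbMatrix_chain_index (hy : L.blk y + 1 = κ) (hμ : μ ≠ 0) (hε : ε ^ 2 = 1) :
    (ctrbMatrix (L.chainA y μ ε) (L.chainB y μ ε) κ).rank = n := by
  rw [L.rank_ctrbMatrix_chain hy hμ hε le_rfl,
    Finset.filter_true_of_mem fun i _ => L.blk_lt i, Finset.card_univ, Fintype.card_fin]

theorem ctrbIndex_chain (hy : L.blk y + 1 = κ) (hμ : μ ≠ 0) (hε : ε ^ 2 = 1) :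
    ctrbIndex (L.chainA y μ ε) (L.chainB y μ ε) = κ := by
  refine IsLeast.csInf_eq ⟨⟨L.index_pos, L.rank_ctrbMatrix_chain_index hy hμ hε⟩, ?_⟩
  rintro k ⟨-, hk⟩
  by_contra! hlt
  rw [L.rank_ctrbMatrix_chain hy hμ hε hlt.le] at hk
  have hfull := (Finset.card_eq_iff_eq_univ _).1 (hk.trans (Fintype.card_fin n).symm)
  have hyk := (Finset.mem_filter.1 (hfull ▸ Finset.mem_univ y)).2
  lia

theorem blockSize_chain (hy : L.blk y + 1 = κ) (hμ : μ ≠ 0) (hε : ε ^ 2 = 1) {b : ℕ}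
    (hb : b < κ) : blockSize (L.chainA y μ ε) (L.chainB y μ ε) b = L.size b := by
  have hdisj : Disjoint (Finset.univ.filter fun i => L.blk i < b)
      (Finset.univ.filter fun i => L.blk i = b) :=
    Finset.disjoint_filter.2 fun _ _ h => h.ne
  have hunion : (Finset.univ.filter fun i => L.blk i < b + 1) =
      (Finset.univ.filter fun i => L.blk i < b) ∪ (Finset.univ.filter fun i => L.blk i = b) := by
    simp only [← Finset.filter_or, Nat.lt_succ_iff_lt_or_eq]
  rw [blockSize, L.rank_ctrbMatrix_chain hy hμ hε hb, L.rank_ctrbMatrix_chain hy hμ hε hb.le,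
    hunion, Finset.card_union_of_disjoint hdisj, L.card_filter_blk_eq hb, Nat.add_sub_cancel_left]

theorem chainB_mul_transpose (hε : ε ^ 2 = 1) :
    L.chainB y μ ε * (L.chainB y μ ε)ᵀ =
      Matrix.diagonal fun i => if L.blk i = 0 then μ ^ 2 else 0 := by
  classical
  rw [mul_transpose_eq_diagonal_of_matching (r := fun i (a : Fin p) => L.blk i = 0 ∧ L.pos i = a)
    (c := fun i => μ * (Function.update 1 y ε : Fin n → ℝ) i)]
  · congr 1
    ext i
    rw [mul_pow, update_one_sq hε, mul_one]
    exact if_congr ⟨fun ⟨_, h, _⟩ => h, fun h => ⟨⟨L.pos i, L.pos_lt_input i⟩, h, rfl⟩⟩ rfl rfl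
  · exact ⟨fun i a j h h' => eq_of_blk_eq_of_pos_eq (h.1.trans h'.1.symm) (h.2.trans h'.2.symm),
      fun i a a' h h' => Fin.ext (h.2.symm.trans h'.2)⟩
  · exact L.chainB_apply

theorem shift_mul_single_eq_zero (hy : L.blk y + 1 = κ) : L.shift * Matrix.single y y 1 = 0 := by
  ext i j
  by_cases hj : j = y
  · have hi := L.blk_lt i
    rw [hj, Matrix.mul_single_apply_same, shift, Matrix.of_apply, if_neg (by lia), zero_mul,
      Matrix.zero_apply]
  · rw [Matrix.mul_single_apply_of_ne _ _ _ _ _ hj, Matrix.zero_apply]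

theorem smul_signMatrix_mul_shift_mul_transpose (hε : ε ^ 2 = 1) :
    μ • (signMatrix y ε * L.shift) * (μ • (signMatrix y ε * L.shift))ᵀ =
      Matrix.diagonal fun i => if L.blk i = 0 then 0 else μ ^ 2 := by
  classical
  rw [mul_transpose_eq_diagonal_of_matching
    (r := fun i j => L.blk i = L.blk j + 1 ∧ L.pos i = L.pos j)
    (c := fun i => μ * (Function.update 1 y ε : Fin n → ℝ) i)]
  · congr 1
    ext i
    rw [mul_pow, update_one_sq hε, mul_one, ← ite_not]
    exact if_congr ⟨fun h => by_contra fun hi => h (L.exists_pred hi), fun h ⟨j, hj⟩ => by lia⟩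
      rfl rfl
  · exact ⟨fun i j i' h h' => eq_of_blk_eq_of_pos_eq (h.1.trans h'.1.symm) (h.2.trans h'.2.symm),
      fun i j j' h h' => eq_of_blk_eq_of_pos_eq (L := L) (by lia) (by lia)⟩
  · intro i j
    rw [Matrix.smul_apply, signMatrix_mul_apply, shift, Matrix.of_apply, smul_eq_mul, ← mul_assoc,
      mul_ite, mul_one, mul_zero]

theorem chainA_mul_transpose (hy : L.blk y + 1 = κ) (hε : ε ^ 2 = 1) :
    L.chainA y μ ε * (L.chainA y μ ε)ᵀ =
      Matrix.diagonal (Pi.single y 1 + fun i => if L.blk i = 0 then 0 else μ ^ 2) := by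
  have hcross : μ • (signMatrix y ε * L.shift) * Matrix.single y y 1 = 0 := by
    rw [Matrix.smul_mul, Matrix.mul_assoc, L.shift_mul_single_eq_zero hy, Matrix.mul_zero,
      smul_zero]
  have hcross' : Matrix.single y y 1 * (μ • (signMatrix y ε * L.shift))ᵀ = 0 := by
    rw [← Matrix.transpose_single, ← Matrix.transpose_mul, hcross, Matrix.transpose_zero]
  rw [chainA, Matrix.transpose_add, Matrix.add_mul, Matrix.mul_add, Matrix.mul_add,
    Matrix.transpose_single, hcross, hcross', L.smul_signMatrix_mul_shift_mul_transpose hε,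
    Matrix.single_mul_single_same, mul_one, add_zero, zero_add, ← Matrix.diagonal_single]
  exact Matrix.diagonal_add _ _

theorem norm_chainA_le (hy : L.blk y + 1 = κ) (hε : ε ^ 2 = 1) (hM : 1 ≤ M)
    (hMκ : 2 ≤ κ → √(1 + μ ^ 2) ≤ M) : ‖L.chainA y μ ε‖ ≤ M := by
  have hM₀ : 0 ≤ M := zero_le_one.trans hM
  refine l2_opNorm_le_of_mul_transpose_eq_diagonal (L.chainA_mul_transpose hy hε) hM₀ fun i => ?_
  have hsingle : (Pi.single y 1 : Fin n → ℝ) i ∈ Set.Icc 0 1 := by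
    rw [Pi.single_apply]
    split_ifs <;> simp
  rw [Pi.add_apply]
  by_cases hi : L.blk i = 0
  · rw [if_pos hi, add_zero, abs_of_nonneg hsingle.1]
    exact hsingle.2.trans (one_le_pow₀ hM)
  · have hκ : 2 ≤ κ := by have := L.blk_lt i; lia
    rw [if_neg hi, abs_of_nonneg (add_nonneg hsingle.1 (sq_nonneg μ))]
    exact (add_le_add_left hsingle.2 _).trans ((Real.sqrt_le_left hM₀).1 (hMκ hκ))

theorem norm_chainB_le (hμ : 0 ≤ μ) (hε : ε ^ 2 = 1) (hM : μ ≤ M) : ‖L.chainB y μ ε‖ ≤ M := by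
  refine l2_opNorm_le_of_mul_transpose_eq_diagonal (L.chainB_mul_transpose hε) (hμ.trans hM)
    fun i => ?_
  split_ifs
  · rw [abs_of_nonneg (sq_nonneg μ)]
    gcongr
  · rw [abs_zero]
    exact sq_nonneg M

theorem norm_chainH_le (hM : 1 ≤ M) : ‖chainH y‖ ≤ M := by
  refine l2_opNorm_le_of_mul_transpose_eq_diagonal (d := Pi.single y 1) ?_ (zero_le_one.trans hM)
    fun i => ?_
  · rw [chainH, Matrix.transpose_single, Matrix.single_mul_single_same, mul_one,
      Matrix.diagonal_single]
  · refine le_trans ?_ (one_le_pow₀ hM)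
    rw [Pi.single_apply]
    split_ifs <;> simp

theorem rank_chainH : (chainH y).rank = 1 := by
  have hgram : (chainH y)ᵀ * chainH y = 1 := by
    rw [chainH, Matrix.transpose_single, Matrix.single_mul_single_same, mul_one]
    ext i j
    rw [Matrix.one_apply, if_pos (Subsingleton.elim i j), Subsingleton.elim i 0,
      Subsingleton.elim j 0, Matrix.single_apply_same]
  rw [← Matrix.rank_transpose_mul_self, hgram, Matrix.rank_one, Fintype.card_fin]

theorem rho_chainA_le_one : rho (L.chainA y μ ε) ≤ 1 := by
  have hentry (i j : Fin n) (h : L.blk i ≤ L.blk j) :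
      L.chainA y μ ε i j = Matrix.single y y (1 : ℝ) i j := by
    rw [chainA, Matrix.add_apply, Matrix.smul_apply, signMatrix_mul_apply, shift, Matrix.of_apply,
      if_neg (by lia), mul_zero, smul_zero, add_zero]
  refine rho_le_of_triangular L.blk (c := 1) (fun i j hij h => ?_) fun i => ?_
  · rw [hentry i j h, Matrix.single_apply, if_neg fun hy => hij (hy.1.symm.trans hy.2)]
  · rw [hentry i i le_rfl, Matrix.single_apply]
    split_ifs <;> simp

end StaircaseLayout

end Chain

section RobustCoupling

variable {n p κ : ℕ}

theorem rank_ctrbMatrix_zero (A : Matrix (Fin n) (Fin n) ℝ) (B : Matrix (Fin n) (Fin p) ℝ) :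
    (ctrbMatrix A B 0).rank = 0 := by
  simpa using (ctrbMatrix A B 0).rank_le_card_width

theorem blockSize_zero (A : Matrix (Fin n) (Fin n) ℝ) (B : Matrix (Fin n) (Fin p) ℝ) :
    blockSize A B 0 = B.rank := by
  have hone : ctrbMatrix A B 1 =
      B.submatrix (Equiv.refl (Fin n)) (Equiv.uniqueProd (Fin p) (Fin 1)) := by
    ext i ⟨t, a⟩
    simp [ctrbMatrix, Subsingleton.elim t 0]
  rw [blockSize, zero_add, hone, Matrix.rank_submatrix, rank_ctrbMatrix_zero, Nat.sub_zero]

theorem ctrbIndex_pos {A : Matrix (Fin n) (Fin n) ℝ} {B : Matrix (Fin n) (Fin p) ℝ}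
    (h : IsControllable A B) : 0 < ctrbIndex A B := by
  suffices hne : {k : ℕ | 1 ≤ k ∧ (ctrbMatrix A B k).rank = n}.Nonempty from (Nat.sInf_mem hne).1
  obtain ⟨k, -, hk⟩ := h
  obtain rfl | hk₀ := k.eq_zero_or_pos
  · rw [rank_ctrbMatrix_zero] at hk
    have hle := (ctrbMatrix A B 1).rank_le_card_height
    rw [Fintype.card_fin] at hle
    exact ⟨1, le_rfl, by lia⟩
  · exact ⟨k, hk₀, hk⟩

theorem isRobustlyCoupled_of_equiv {A : Matrix (Fin n) (Fin n) ℝ} {B : Matrix (Fin n) (Fin p) ℝ}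
    {μ : ℝ} (hμ : 0 < μ) (hc : IsControllable A B) (e : Fin n ≃ StairIdx A B)
    (hB₀ : ∀ (s : StairIdx A B) (a : Fin p), 0 < (s.1 : ℕ) → B (e.symm s) a = 0)
    (hA₀ : ∀ s s' : StairIdx A B, (s'.1 : ℕ) + 1 < s.1 → A (e.symm s) (e.symm s') = 0)
    (hB : ∀ i : Fin (ctrbIndex A B), (i : ℕ) = 0 →
      μ ≤ sigmaVal p (B.submatrix (fun a : Fin (blockSize A B i) => e.symm ⟨i, a⟩) id))
    (hA : ∀ i j : Fin (ctrbIndex A B), (j : ℕ) = i + 1 →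
      μ ≤ sigmaVal (blockSize A B j) (A.submatrix
        (fun a : Fin (blockSize A B j) => e.symm ⟨j, a⟩)
        fun a : Fin (blockSize A B i) => e.symm ⟨i, a⟩)) :
    IsRobustlyCoupled μ A B := by
  set U : Matrix (Fin n) (StairIdx A B) ℝ := (1 : Matrix _ _ ℝ).submatrix id e.symm with hU
  have hUt : Uᵀ = (1 : Matrix _ _ ℝ).submatrix e.symm id := by
    rw [hU, Matrix.transpose_submatrix, Matrix.transpose_one]
  have hleft {m : ℕ} (X : Matrix (Fin n) (Fin m) ℝ) : Uᵀ * X = X.submatrix e.symm id := by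
    rw [hUt]
    exact Matrix.one_submatrix_mul _ (Equiv.refl _) X
  have hright {m : Type} (X : Matrix m (Fin n) ℝ) : X * U = X.submatrix id e.symm :=
    Matrix.mul_submatrix_one (Equiv.refl _) _ X
  have hinput (i) : inputBlock A B U i = B.submatrix (fun a => e.symm ⟨i, a⟩) id := by
    rw [inputBlock, hleft, Matrix.submatrix_submatrix]
    rfl
  have hstate (i j) : stateBlock A B U i j =
      A.submatrix (fun a => e.symm ⟨i, a⟩) fun a => e.symm ⟨j, a⟩ := by
    rw [stateBlock, hright, hleft, Matrix.submatrix_submatrix, Matrix.submatrix_submatrix]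
    rfl
  refine ⟨hμ, hc, U, ⟨?_, ?_, ?_, ?_⟩, ?_, ?_⟩
  · rw [hright, hUt, Matrix.submatrix_submatrix]
    exact Matrix.submatrix_one_equiv e.symm
  · rw [hUt, hU, Matrix.submatrix_mul_equiv, Matrix.one_mul, Matrix.submatrix_id_id]
  · exact fun i hi => by rw [hinput]; ext a b; exact hB₀ ⟨i, a⟩ b hi
  · exact fun i j hij => by rw [hstate]; ext a b; exact hA₀ ⟨i, a⟩ ⟨j, b⟩ hij
  · exact fun i hi => by rw [hinput]; exact hB i hi
  · exact fun i j hij => by rw [hstate]; exact hA i j hij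

theorem mul_transpose_eq_smul_one_of_apply {a b : ℕ} (hab : a ≤ b)
    {X : Matrix (Fin a) (Fin b) ℝ} {c : Fin a → ℝ} {d : ℝ} (hc : ∀ i, c i ^ 2 = d)
    (hX : ∀ i j, X i j = if (i : ℕ) = j then c i else 0) : X * Xᵀ = d • 1 := by
  classical
  rw [mul_transpose_eq_diagonal_of_matching (r := fun (i : Fin a) (j : Fin b) => (i : ℕ) = j)
    ⟨fun i j i' h h' => Fin.ext (h.trans h'.symm), fun i j j' h h' => Fin.ext (h.symm.trans h')⟩ hX,
    Matrix.smul_one_eq_diagonal]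
  congr 1
  ext i
  rw [if_pos ⟨i.castLE hab, rfl⟩, hc]

namespace StaircaseLayout

variable (L : StaircaseLayout n p κ)

theorem exists_equiv_stairIdx {A : Matrix (Fin n) (Fin n) ℝ} {B : Matrix (Fin n) (Fin p) ℝ}
    (hκ : ctrbIndex A B = κ) (hsize : ∀ b < κ, blockSize A B b = L.size b) :
    ∃ e : Fin n ≃ StairIdx A B,
      ∀ s, L.blk (e.symm s) = s.1 ∧ L.pos (e.symm s) = s.2 := by
  let f : (b : Fin κ) × Fin (L.size b) ≃ StairIdx A B :=
    Equiv.sigmaCongr (finCongr hκ.symm) fun b => finCongr (hsize b b.2).symm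
  let e := L.coord.trans f
  refine ⟨e, fun s => ⟨?_, ?_⟩⟩
  · exact congrArg (fun s : StairIdx A B => (s.1 : ℕ)) (e.apply_symm_apply s)
  · exact congrArg (fun s : StairIdx A B => (s.2 : ℕ)) (e.apply_symm_apply s)

theorem isRobustlyCoupled_chain {y : Fin n} (hy : L.blk y + 1 = κ) {μ ε : ℝ} (hμ : 0 < μ)
    (hε : ε ^ 2 = 1) : IsRobustlyCoupled μ (L.chainA y μ ε) (L.chainB y μ ε) := by
  have hκ := L.ctrbIndex_chain hy hμ.ne' hε
  have hsize {b : ℕ} (hb : b < κ) := L.blockSize_chain hy hμ.ne' hε hb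
  obtain ⟨e, he⟩ := L.exists_equiv_stairIdx hκ fun b => hsize
  have hgain (i : Fin n) : (μ * (Function.update 1 y ε : Fin n → ℝ) i) ^ 2 = μ ^ 2 := by
    rw [mul_pow, update_one_sq hε, mul_one]
  refine isRobustlyCoupled_of_equiv hμ ⟨κ, L.index_le, L.rank_ctrbMatrix_chain_index hy hμ.ne' hε⟩ e
    (fun s a hs => ?_) (fun s s' hs => ?_) (fun i hi => ?_) fun i j hij => ?_
  · rw [L.chainB_apply, (he s).1, if_neg fun h => hs.ne' h.1]
  · rw [L.chainA_apply_of_blk_ne (by rw [(he s).1, (he s').1]; lia), (he s).1, (he s').1,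
      if_neg (by lia)]
  · have hκ₀ := L.index_pos
    have hip : blockSize (L.chainA y μ ε) (L.chainB y μ ε) i = p := by
      rw [hi, hsize hκ₀, L.size_zero]
    have hp : 0 < p := L.size_zero ▸ L.size_pos 0 hκ₀
    refine (sigmaVal_eq_of_mul_transpose_eq_smul_one hμ (mul_transpose_eq_smul_one_of_apply hip.le
      (fun a => hgain (e.symm ⟨i, a⟩)) fun a b => ?_) (by lia)).ge
    simp only [Matrix.submatrix_apply, id_eq, L.chainB_apply, he, hi, true_and]
  · have hj : (j : ℕ) < κ := j.2.trans_eq hκ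
    have hi : (i : ℕ) < κ := i.2.trans_eq hκ
    have hpos := L.size_pos j hj
    refine (sigmaVal_eq_of_mul_transpose_eq_smul_one hμ (mul_transpose_eq_smul_one_of_apply ?_
      (fun a => hgain (e.symm ⟨j, a⟩)) fun a b => ?_) (by rw [hsize hj]; lia)).ge
    · rw [hsize hj, hsize hi, hij]
      exact L.size_succ_le i (hij ▸ hj)
    · rw [Matrix.submatrix_apply, L.chainA_apply_of_blk_ne (by rw [(he _).1, (he _).1]; lia)]
      simp only [he, hij, true_and]

theorem chainSys_mem_robustClass {y : Fin n} (hy : L.blk y + 1 = κ) {μ ε M : ℝ} (hμ : 0 < μ)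
    (hε : ε ^ 2 = 1) (hμM : μ ≤ M) (hM : 1 ≤ M) (hMκ : 2 ≤ κ → √(1 + μ ^ 2) ≤ M) :
    L.chainSys y μ ε ∈ robustClass n p κ μ M := by
  refine ⟨L.norm_chainA_le hy hε hM hMκ, L.norm_chainB_le hμ.le hε hμM, norm_chainH_le hM, ?_,
    rank_chainH, L.rho_chainA_le_one, L.isRobustlyCoupled_chain hy hμ hε,
    L.ctrbIndex_chain hy hμ.ne' hε⟩
  rw [chainSys, ← blockSize_zero (L.chainA y μ ε), L.blockSize_chain hy hμ.ne' hε L.index_pos,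
    L.size_zero]

end StaircaseLayout

theorem nonempty_staircaseLayout_of_mem_robustClass {μ M : ℝ} {S : LinSys n p}
    (hS : S ∈ robustClass n p κ μ M) : Nonempty (StaircaseLayout n p κ) := by
  obtain ⟨-, -, -, hB, -, -, ⟨hμ, hc, U, hU, hin, hsub⟩, rfl⟩ := hS
  have hp : blockSize S.A S.B 0 = p := (blockSize_zero S.A S.B).trans hB
  refine ⟨⟨blockSize S.A S.B, Matrix.indexEquivOfInv hU.mul_transpose hU.transpose_mul,
    ctrbIndex_pos hc, hp, fun b hb => ?_, fun b hb => ?_⟩⟩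
  · obtain _ | b := b
    · have h := sigmaVal_pos_iff.1 (hμ.trans_le (hin ⟨0, hb⟩ rfl))
      have h' := h.trans_le (Matrix.rank_le_width _)
      lia
    · have h := sigmaVal_pos_iff.1 (hμ.trans_le (hsub ⟨b, by lia⟩ ⟨b + 1, hb⟩ rfl))
      have h' := h.trans_le (Matrix.rank_le_height _)
      lia
  · have h := sigmaVal_pos_iff.1 (hμ.trans_le (hsub ⟨b, by lia⟩ ⟨b + 1, hb⟩ rfl))
    have h' := h.trans_le (Matrix.rank_le_width _)
    dsimp at h'
    lia

end RobustCoupling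

section ChainDynamics

open InformationTheory

namespace StaircaseLayout

variable {n p κ : ℕ} (L : StaircaseLayout n p κ) {y : Fin n} {μ ε : ℝ}

/-- The vector whose entry at each coordinate is the state, or the input, that drives it. -/
noncomputable def drive (x : Vec n) (u : Vec p) : Vec n :=
  Matrix.toEuclideanLin L.shift x + Matrix.toEuclideanLin L.feed u

theorem drive_apply_of_pred {i j : Fin n} (hb : L.blk i = L.blk j + 1) (hp : L.pos i = L.pos j)
    (x : Vec n) (u : Vec p) : L.drive x u i = x j := by
  have hshift : Matrix.toEuclideanLin L.shift x i = x j := L.shift_mulVec_of_pred hb hp x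
  have hfeed : Matrix.toEuclideanLin L.feed u i = 0 :=
    L.feed_mulVec_of_blk_ne_zero (hb.trans_ne (Nat.succ_ne_zero _)) u
  rw [drive, PiLp.add_apply, hshift, hfeed, add_zero]

theorem drive_apply_of_blk_eq_zero {i : Fin n} (hi : L.blk i = 0) (x : Vec n) (u : Vec p) :
    L.drive x u i = u ⟨L.pos i, L.pos_lt_input i⟩ := by
  have hshift : Matrix.toEuclideanLin L.shift x i = 0 := L.shift_mulVec_of_blk_eq_zero hi x
  have hfeed : Matrix.toEuclideanLin L.feed u i = u ⟨L.pos i, L.pos_lt_input i⟩ :=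
    L.feed_mulVec_of_blk_eq_zero hi u
  rw [drive, PiLp.add_apply, hshift, hfeed, zero_add]

theorem stateAt_chainSys_succ_apply {𝒜 : Type*} [MeasurableSpace 𝒜] (pol : Policy n p 𝒜) (t : ℕ)
    (ω : 𝒜 × (ℕ → Vec (L.chainSys y μ ε).r)) {i : Fin n} (hi : i ≠ y) :
    stateAt (L.chainSys y μ ε) pol (t + 1) ω i =
      μ * L.drive (stateAt (L.chainSys y μ ε) pol t ω) (inputAt (L.chainSys y μ ε) pol t ω) i := by
  have hrow {m : ℕ} (X : Matrix (Fin n) (Fin m) ℝ) (a : Fin m) :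
      (μ • (signMatrix y ε * X)) i a = μ * X i a := by
    rw [Matrix.smul_apply, signMatrix_mul_apply, Function.update_of_ne hi, Pi.one_apply, one_mul,
      smul_eq_mul]
  have hA (x : Vec n) : Matrix.toEuclideanLin (L.chainA y μ ε) x i =
      μ * Matrix.toEuclideanLin L.shift x i := by
    simp only [Matrix.toLpLin_apply, Matrix.mulVec, dotProduct, chainA, Matrix.add_apply, hrow,
      Matrix.single_apply_of_row_ne hi.symm, zero_add, mul_assoc, Finset.mul_sum]
  have hB (u : Vec p) : Matrix.toEuclideanLin (L.chainB y μ ε) u i =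
      μ * Matrix.toEuclideanLin L.feed u i := by
    simp only [Matrix.toLpLin_apply, Matrix.mulVec, dotProduct, chainB, hrow, mul_assoc,
      Finset.mul_sum]
  have hH (w : Vec 1) : Matrix.toEuclideanLin (chainH y) w i = 0 := by
    simp only [Matrix.toLpLin_apply, Matrix.mulVec, dotProduct, chainH,
      Matrix.single_apply_of_row_ne hi.symm, zero_mul, Finset.sum_const_zero]
  rw [stateAt_succ, PiLp.add_apply, PiLp.add_apply]
  refine (congrArg₂ (· + ·) (congrArg₂ (· + ·) (hA _) (hB _)) (hH _)).trans ?_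
  rw [drive, PiLp.add_apply, mul_add, add_zero]

theorem lintegral_drive_sq_le (hy : L.blk y + 1 = κ) {𝒜 : Type*} [MeasurableSpace 𝒜]
    {pol : Policy n p 𝒜} {ν : Measure 𝒜} {N : ℕ} {σ : ℝ}
    (hE : EnergyBounded (L.chainSys y μ ε) pol ν N σ) {t : ℕ} (ht : t < N) (i : Fin n) :
    ∫⁻ ω, ‖L.drive (stateAt (L.chainSys y μ ε) pol t ω)
        (inputAt (L.chainSys y μ ε) pol t ω) i‖ₑ ^ 2 ∂signalNoiseLaw ν (L.chainSys y μ ε).r ≤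
      ‖μ ^ L.blk i‖ₑ ^ 2 * ENNReal.ofReal (σ ^ 2) := by
  set S := L.chainSys y μ ε
  induction hb : L.blk i generalizing i t with
  | zero =>
    simp only [L.drive_apply_of_blk_eq_zero hb, pow_zero, enorm_one, one_pow, one_mul]
    refine le_trans (lintegral_mono fun ω => ?_) (hE.lintegral_inputAt_le ht)
    gcongr
    exact PiLp.enorm_apply_le _ _
  | succ b ih =>
    obtain ⟨j, hbj, hpj⟩ := L.exists_pred (hb.trans_ne b.succ_ne_zero)
    have hjy : j ≠ y := by
      rintro rfl
      have hi := L.blk_lt i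
      lia
    simp only [L.drive_apply_of_pred hbj hpj]
    obtain _ | t := t
    · simp [stateAt_zero]
    · have hpow : ‖μ ^ (b + 1)‖ₑ ^ 2 = ‖μ‖ₑ ^ 2 * ‖μ ^ b‖ₑ ^ 2 := by
        rw [pow_succ' μ b, enorm_mul, mul_pow]
      simp only [S, L.stateAt_chainSys_succ_apply pol t _ hjy, enorm_mul, mul_pow]
      rw [lintegral_const_mul' _ _ (by finiteness), hpow, mul_assoc]
      gcongr
      exact ih (by lia) j (by lia)

theorem signMatrix_one : signMatrix y 1 = 1 := by
  rw [signMatrix, show Function.update (1 : Fin n → ℝ) y 1 = 1 from Function.update_eq_self y 1,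
    Matrix.diagonal_one']

theorem signMatrix_neg_one : signMatrix y (-1) = 1 - (2 : ℝ) • (chainH y * (chainH y)ᵀ) := by
  rw [chainH, Matrix.transpose_single, Matrix.single_mul_single_same, mul_one]
  ext i j
  obtain rfl | hij := eq_or_ne i j
  · obtain rfl | hi := eq_or_ne i y
    · norm_num [signMatrix]
    · simp [signMatrix, hi, hi.symm]
  · simp only [signMatrix, Matrix.diagonal_apply_ne _ hij, Matrix.sub_apply,
      Matrix.one_apply_ne hij, Matrix.smul_apply, Matrix.single_apply, smul_eq_mul]
    rw [if_neg fun h => hij (h.1.symm.trans h.2), mul_zero, sub_zero]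

theorem chainSys_neg_one :
    L.chainSys y μ (-1) = noiseFeedback (L.chainSys y μ 1)
      ((-2 * μ) • ((chainH y)ᵀ * L.shift)) ((-2 * μ) • ((chainH y)ᵀ * L.feed)) := by
  have hsign {m : ℕ} (X : Matrix (Fin n) (Fin m) ℝ) :
      μ • (signMatrix y (-1) * X) =
        μ • (signMatrix y 1 * X) + chainH y * ((-2 * μ) • ((chainH y)ᵀ * X)) := by
    rw [signMatrix_one, signMatrix_neg_one, Matrix.sub_mul, Matrix.smul_mul, Matrix.mul_smul,
      Matrix.mul_assoc]
    module
  have hA : L.chainA y μ (-1) =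
      L.chainA y μ 1 + chainH y * ((-2 * μ) • ((chainH y)ᵀ * L.shift)) := by
    rw [chainA, chainA, hsign, add_assoc]
  exact congrArg₂ (fun A B => (⟨1, A, B, chainH y⟩ : LinSys n p)) hA (hsign L.feed)

theorem norm_toEuclideanLin_transpose_chainH (x : Vec n) :
    ‖Matrix.toEuclideanLin (chainH y)ᵀ x‖ = ‖x y‖ := by
  have hentry : Matrix.toEuclideanLin (chainH y)ᵀ x 0 = x y := by
    simp [chainH, Matrix.toLpLin_apply, Matrix.mulVec, dotProduct, Matrix.single_apply]
  rw [← hentry, EuclideanSpace.norm_eq, Fin.sum_univ_one, Real.sqrt_sq (norm_nonneg _)]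

theorem enorm_sq_eq_ofReal_sq (a : ℝ) : ‖a‖ₑ ^ 2 = ENNReal.ofReal (a ^ 2) := by
  rw [← ofReal_norm, ← ENNReal.ofReal_pow (norm_nonneg _), Real.norm_eq_abs, sq_abs]

theorem ofReal_norm_sq_noise_shift_eq (x : Vec n) (u : Vec p) :
    ENNReal.ofReal
        (‖Matrix.toEuclideanLin ((-2 * μ) • ((chainH y)ᵀ * L.shift)) x +
          Matrix.toEuclideanLin ((-2 * μ) • ((chainH y)ᵀ * L.feed)) u‖ ^ 2 / 2) =
      ENNReal.ofReal (2 * μ ^ 2) * ‖L.drive x u y‖ₑ ^ 2 := by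
  rw [map_smul, map_smul, LinearMap.smul_apply, LinearMap.smul_apply,
    toEuclideanLin_mul_apply, toEuclideanLin_mul_apply, ← smul_add, ← map_add, ← drive,
    norm_smul, norm_toEuclideanLin_transpose_chainH, mul_pow, Real.norm_eq_abs, Real.norm_eq_abs,
    sq_abs, sq_abs, enorm_sq_eq_ofReal_sq, ← ENNReal.ofReal_mul (by positivity)]
  congr 1
  ring

theorem klDiv_dataLaw_chainSys_le (hy : L.blk y + 1 = κ) {𝒜 : Type*} [MeasurableSpace 𝒜]
    {pol : Policy n p 𝒜} {ν : Measure 𝒜} [IsProbabilityMeasure ν] {N : ℕ} {σ : ℝ}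
    (hE : EnergyBounded (L.chainSys y μ (-1)) pol ν N σ) :
    klDiv (dataLaw (L.chainSys y μ (-1)) pol ν N) (dataLaw (L.chainSys y μ 1) pol ν N) ≤
      ENNReal.ofReal (2 * μ ^ (2 * κ) * (N * σ ^ 2)) := by
  set S := L.chainSys y μ (-1)
  have hstep : ∀ t ∈ Finset.range N, ∫⁻ ω, ENNReal.ofReal
      (‖Matrix.toEuclideanLin ((-2 * μ) • ((chainH y)ᵀ * L.shift)) (stateAt S pol t ω) +
        Matrix.toEuclideanLin ((-2 * μ) • ((chainH y)ᵀ * L.feed)) (inputAt S pol t ω)‖ ^ 2 / 2)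
      ∂signalNoiseLaw ν S.r ≤ ENNReal.ofReal (2 * μ ^ (2 * κ) * σ ^ 2) := by
    intro t ht
    have hdrive := L.lintegral_drive_sq_le hy hE (Finset.mem_range.1 ht) y
    simp only [L.ofReal_norm_sq_noise_shift_eq]
    rw [lintegral_const_mul' _ _ (by finiteness)]
    refine (mul_le_mul_right hdrive _).trans_eq ?_
    have hκ : μ ^ (2 * κ) = (μ * μ ^ L.blk y) ^ 2 := by rw [← pow_succ', hy, ← pow_mul, mul_comm]
    rw [enorm_sq_eq_ofReal_sq, hκ, mul_pow, ← ENNReal.ofReal_mul (sq_nonneg _),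
      ← ENNReal.ofReal_mul (by positivity), mul_assoc 2, mul_assoc 2, mul_assoc (μ ^ 2)]
  have hkl := klDiv_dataLaw_noiseFeedback_le (L.chainSys y μ 1)
    ((-2 * μ) • ((chainH y)ᵀ * L.shift)) ((-2 * μ) • ((chainH y)ᵀ * L.feed)) pol ν N
  rw [← L.chainSys_neg_one] at hkl
  refine hkl.trans ((Finset.sum_le_card_nsmul _ _ _ hstep).trans_eq ?_)
  rw [Finset.card_range, nsmul_eq_mul, ← ENNReal.ofReal_natCast,
    ← ENNReal.ofReal_mul (Nat.cast_nonneg N)]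
  congr 1
  ring

theorem det_one_sub_chain (K : Matrix (Fin p) (Fin n) ℝ) :
    (1 - (L.chainA y μ ε + L.chainB y μ ε * K)).det =
      ε * (1 - Matrix.single y y 1 - μ • (L.shift + L.feed * K)).det := by
  have hrow : (1 - Matrix.single y y (1 : ℝ)) y = 0 := by
    ext j
    rw [Matrix.sub_apply, Matrix.one_apply, Matrix.single_apply]
    simp
  have hfactor : 1 - (L.chainA y μ ε + L.chainB y μ ε * K) =
      signMatrix y ε * (1 - Matrix.single y y 1 - μ • (L.shift + L.feed * K)) := by
    rw [Matrix.mul_sub, signMatrix_mul_of_row_eq_zero hrow, chainA, chainB, Matrix.mul_smul,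
      Matrix.mul_add, smul_add, Matrix.smul_mul, Matrix.mul_assoc]
    abel
  rw [hfactor, Matrix.det_mul, signMatrix, Matrix.det_diagonal,
    Finset.prod_update_of_mem (Finset.mem_univ y)]
  simp

end StaircaseLayout

end ChainDynamics

section Testing

open InformationTheory

variable {n p N : ℕ}

theorem measurable_det_one_sub (A : Matrix (Fin n) (Fin n) ℝ) (B : Matrix (Fin n) (Fin p) ℝ)
    (K : GainEstimator n p N) : Measurable fun d => (1 - (A + B * K.gain d)).det := by
  simp only [Matrix.det_apply', Matrix.sub_apply, Matrix.add_apply, Matrix.mul_apply]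
  refine Finset.measurable_fun_sum _ fun τ _ => Measurable.const_mul ?_ _
  refine Finset.measurable_fun_prod _ fun i _ => measurable_const.sub (measurable_const.add ?_)
  exact Finset.measurable_fun_sum _ fun j _ => (K.measurable_gain j i).const_mul _

/-- The sign of `det (1 - (A + B K))` tells on which of the two systems the estimated gain fails,
so the estimator is a test between them. -/
theorem log_le_klDiv_dataLaw_of_det_eq_neg {S S' : LinSys n p}
    (hdet : ∀ K : Matrix (Fin p) (Fin n) ℝ,
      (1 - (S'.A + S'.B * K)).det = -(1 - (S.A + S.B * K)).det)
    {𝒜 : Type*} [MeasurableSpace 𝒜] {ν : Measure 𝒜} [IsProbabilityMeasure ν]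
    {pol : Policy n p 𝒜} {K : GainEstimator n p N} {δ : ℝ} (hδ₀ : 0 ≤ δ) (hδ₁ : δ < 1 / 2)
    (hS : failureProb S pol ν N K ≤ ENNReal.ofReal δ)
    (hS' : failureProb S' pol ν N K ≤ ENNReal.ofReal δ)
    (hkl : klDiv (dataLaw S' pol ν N) (dataLaw S pol ν N) ≠ ∞) :
    0 < δ ∧ Real.log (1 / (3 * δ)) ≤ (klDiv (dataLaw S' pol ν N) (dataLaw S pol ν N)).toReal := by
  have hmeas : MeasurableSet {d | (1 - (S.A + S.B * K.gain d)).det ≤ 0} :=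
    measurableSet_le (measurable_det_one_sub S.A S.B K) measurable_const
  refine log_one_div_three_mul_le_klDiv hmeas hδ₁ ?_ ?_ hkl
  · refine ENNReal.toReal_le_of_le_ofReal hδ₀ (le_trans (measure_mono fun d hd => ?_) hS)
    exact one_le_rho_of_det_one_sub_nonpos hd
  · refine ENNReal.toReal_le_of_le_ofReal hδ₀ (le_trans (measure_mono fun d hd => ?_) hS')
    refine one_le_rho_of_det_one_sub_nonpos ?_
    rw [hdet, neg_nonpos]
    exact le_of_not_ge hd

end Testing

theorem mul_one_sub_div_sq_le {κ : ℕ} (hκ : 0 < κ) {μ ℓ C : ℝ} (hμ₀ : 0 < μ) (hμ₁ : μ ≤ 1)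
    (hC : 0 ≤ C) (h : 1 / 2 * (1 / μ) ^ (2 * κ) * ℓ ≤ C) :
    1 / 2 * (1 / μ) ^ (2 * κ - 2) * ((1 - μ) / μ) ^ 2 * ℓ ≤ C := by
  have hpow : 1 / 2 * (1 / μ) ^ (2 * κ - 2) * ((1 - μ) / μ) ^ 2 =
      1 / 2 * (1 / μ) ^ (2 * κ) * (1 - μ) ^ 2 := by
    have hsplit : 2 * κ = 2 * κ - 2 + 2 := by lia
    rw [div_eq_mul_one_div (1 - μ), mul_pow, hsplit, pow_add, Nat.add_sub_cancel]
    ring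
  have hsq : (1 - μ) ^ 2 ≤ 1 := pow_le_one₀ (by linarith) (by linarith)
  rw [hpow, mul_right_comm]
  obtain hℓ | hℓ := le_total (1 / 2 * (1 / μ) ^ (2 * κ) * ℓ) 0
  · exact (mul_nonpos_of_nonpos_of_nonneg hℓ (sq_nonneg _)).trans hC
  · exact (mul_le_of_le_one_right hℓ hsq).trans h

theorem mainTheorem1_general {n p κ N : ℕ} {μ M σ δ : ℝ} (hμ : 0 < μ) (hμM : μ ≤ M) (hM : 1 ≤ M)
    (hMκ : 2 ≤ κ → √(1 + μ ^ 2) ≤ M) (hC : (robustClass n p κ μ M).Nonempty)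
    (hδ₀ : 0 ≤ δ) (hδ₁ : δ < 1 / 2)
    {𝒜 : Type*} [MeasurableSpace 𝒜] (ν : Measure 𝒜) [IsProbabilityMeasure ν]
    (pol : Policy n p 𝒜) (K : GainEstimator n p N)
    (hE : ∀ S ∈ robustClass n p κ μ M, EnergyBounded S pol ν N σ)
    (hreq : (⨆ S ∈ robustClass n p κ μ M, failureProb S pol ν N K) ≤ ENNReal.ofReal δ) :
    0 < δ ∧ 1 / 2 * (1 / μ) ^ (2 * κ) * Real.log (1 / (3 * δ)) ≤ N * σ ^ 2 := by
  obtain ⟨L⟩ := nonempty_staircaseLayout_of_mem_robustClass hC.some_mem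
  obtain ⟨y, hy⟩ : ∃ y, L.blk y + 1 = κ := L.exists_blk_add_one_eq
  have hmem {ε : ℝ} (hε : ε ^ 2 = 1) : L.chainSys y μ ε ∈ robustClass n p κ μ M :=
    L.chainSys_mem_robustClass hy hμ hε hμM hM hMκ
  have hpos := hmem (ε := 1) (one_pow 2)
  have hneg := hmem (ε := -1) (neg_one_sq.trans rfl)
  have hdet (K : Matrix (Fin p) (Fin n) ℝ) :
      (1 - (L.chainA y μ (-1) + L.chainB y μ (-1) * K)).det =
        -(1 - (L.chainA y μ 1 + L.chainB y μ 1 * K)).det := by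
    rw [L.det_one_sub_chain, L.det_one_sub_chain, neg_one_mul, one_mul]
  have hkl := L.klDiv_dataLaw_chainSys_le hy (hE _ hneg)
  have hfail := iSup₂_le_iff.1 hreq
  obtain ⟨hδ, hlog⟩ := log_le_klDiv_dataLaw_of_det_eq_neg hdet hδ₀ hδ₁ (hfail _ hpos)
    (hfail _ hneg) (ne_top_of_le_ne_top ENNReal.ofReal_ne_top hkl)
  refine ⟨hδ, ?_⟩
  calc 1 / 2 * (1 / μ) ^ (2 * κ) * Real.log (1 / (3 * δ))
      ≤ 1 / 2 * (1 / μ) ^ (2 * κ) * (2 * μ ^ (2 * κ) * (N * σ ^ 2)) := by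
        gcongr
        exact hlog.trans (ENNReal.toReal_le_of_le_ofReal (by positivity) hkl)
    _ = N * σ ^ 2 := by
        rw [one_div_pow]
        field_simp

/-- Stabilization from data can be hard. A requirement with `δ = 0`, where the right-hand side of
the bound is `+∞`, can never be met. -/
theorem mainTheorem1 (n p κ N : ℕ) (hn : 1 ≤ n) (μ M σ δ : ℝ)
    (hμ₀ : 0 < μ) (hμ₁ : μ < 1)
    (hM : 1 ≤ M) (hMκ : 2 ≤ κ → √(1 + μ ^ 2) ≤ M)
    (hC : (robustClass n p κ μ M).Nonempty)
    (hσ : 0 < σ) (hδ₀ : 0 ≤ δ) (hδ₁ : δ < 1 / 2)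
    {𝒜 : Type*} [MeasurableSpace 𝒜] (ν : Measure 𝒜) [IsProbabilityMeasure ν]
    (pol : Policy n p 𝒜) (K : GainEstimator n p N)
    (hE : ∀ S ∈ robustClass n p κ μ M, EnergyBounded S pol ν N σ)
    (hreq : (⨆ S ∈ robustClass n p κ μ M, failureProb S pol ν N K) ≤ ENNReal.ofReal δ) :
    0 < δ ∧
      (N : ℝ) * σ ^ 2 ≥
        1 / 2 * (1 / μ) ^ (2 * κ - 2) * ((1 - μ) / μ) ^ 2 * Real.log (1 / (3 * δ)) := by
  have hκ := (nonempty_staircaseLayout_of_mem_robustClass hC.some_mem).some.index_pos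
  exact (mainTheorem1_general hμ₀ (hμ₁.le.trans hM) hM hMκ hC hδ₀ hδ₁ ν pol K hE hreq).imp_right
    (mul_one_sub_div_sq_le hκ hμ₀ hμ₁.le (by positivity))
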